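/- Let $d\in\mathbb N$, let $f\in C^1(\mathbb R;\mathbb R^d)$ be the flux of the scalar conservation law $\partial_t u+\nabla_x\cdot f(u)=0$ on $\mathbb R^d\times\mathbb R_+$, $\mathbb R_+=[0,\infty)$, and let $\sigma\in\mathbf Y(\mathbb R^d)$ be a uniformly bounded (possibly non-atomic) Young measure. Then there exists an entropy measure-valued (EMV) solution $\nu\in\mathbf Y(\mathbb R^d\times\mathbb R_+)$ of the Cauchy problem with initial data $\sigma$, and it can be chosen as follows: there are a probability space $(\Omega,\Sigma,P)$ and jointly measurable random fields $u_0:\Omega\times\mathbb R^d\to\mathbb R$ and $u:\Omega\times(\mathbb R^d\times\mathbb R_+)\to\mathbb R$ such that $u_0$ has law $\sigma$, for every $\omega\in\Omega$ the function $u(\omega;\cdot)$ is an entropy solution with initial data $u_0(\omega;\cdot)$, and $\nu$ is the law of $u$. Here a *Young measure* $\nu\in\mathbf Y(D)$ is a map $z\mapsto\nu_z$ from $D$ to the Borel probability measures on $\mathbb R$ such that $z\mapsto\langle\nu_z,g\rangle=\int g\,d\nu_z$ is Borel measurable for every $g\in C_0(\mathbb R)$; it is *uniformly bounded* if there is a compact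 $K\subset\mathbb R$ with $\operatorname{supp}\nu_z\subset K$ for all $z\in D$; and a jointly measurable $v:\Omega\times D\to\mathbb R$ has *law* $\nu$ if $\nu_z(F)=P(v(\cdot,z)\in F)$ for all $z\in D$ and all Borel sets $F\subset\mathbb R$. An *entropy pair* is a pair $(\eta,q)$, $\eta:\mathbb R\to\mathbb R$ convex, $q:\mathbb R\to\mathbb R^d$, with $q'=\eta' f'$, i.e. $q(b)-q(a)=\int_a^b\eta'(\xi)f'(\xi)\,d\xi$ for all $a,b\in\mathbb R$. The Young measure $\nu$ is an *EMV solution* with initial data $\sigma$ if $$\int_{\mathbb R_+}\int_{\mathbb R^d}\partial_t\phi\,\langle\nu_{(x,t)},\mathrm{id}\rangle+\nabla_x\phi\cdot\langle\nu_{(x,t)},f\rangle\,dx\,dt+\int_{\mathbb R^d}\phi(x,0)\langle\sigma_x,\mathrm{id}\rangle\,dx=0$$ for all $\phi\in C^1_c(\mathbb R^d\times\mathbb R_+)$ and $$\int_{\mathbb R_+}\int_{\mathbb R^d}\partial_t\phi\,\langle\nu_{(x,t)},\eta\rangle+\nabla_x\phi\cdot\langle\nu_{(x,t)},q\rangle\,dx\,dt+\int_{\mathbb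 R^d}\phi(x,0)\langle\sigma_x,\eta\rangle\,dx\ge 0$$ for all entropy pairs $(\eta,q)$ and all $0\le\phi\in C^1_c(\mathbb R^d\times\mathbb R_+)$, all the pairings occurring here being well defined and locally integrable (i.e. the integrand is $\nu_z$-integrable for almost every $z$ and its absolute value has a locally integrable pairing, and likewise for $\sigma$). A function $u\in L^\infty(\mathbb R^d\times\mathbb R_+)$ is an *entropy solution* with initial data $u_0\in L^\infty(\mathbb R^d)$ if $$\int_{\mathbb R_+}\int_{\mathbb R^d}\partial_t\phi\,u+\nabla_x\phi\cdot f(u)\,dx\,dt+\int_{\mathbb R^d}\phi(x,0)u_0(x)\,dx=0$$ for all $\phi\in C^1_c(\mathbb R^d\times\mathbb R_+)$ and $$\int_{\mathbb R_+}\int_{\mathbb R^d}\partial_t\phi\,\eta(u)+\nabla_x\phi\cdot q(u)\,dx\,dt+\int_{\mathbb R^d}\phi(x,0)\eta(u_0(x))\,dx\ge0$$ for all entropy pairs $(\eta,q)$ and all $0\le\phi\in C^1_c(\mathbb R^d\times\mathbb R_+)$. -/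

import Mathlib

open MeasureTheory Set
open scoped ZeroAtInfty

noncomputable section

namespace ScalarCL

/-- Physical space `ℝ^d` with its Euclidean structure and Lebesgue measure. -/
abbrev Space (d : ℕ) : Type := EuclideanSpace ℝ (Fin d)

/-- The time axis `ℝ₊ = [0, ∞)`, with the restriction of Lebesgue measure. -/
abbrev Time : Type := Ici (0 : ℝ)

instance : MeasureSpace Time := Measure.Subtype.measureSpace

instance : IsFiniteMeasureOnCompacts (volume : Measure Time) :=
  .comap' _ continuous_subtype_val (MeasurableEmbedding.subtype_coe measurableSet_Ici)

instance : SigmaFinite (volume : Measure Time) :=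
  haveI : LocallyCompactSpace Time := (isClosed_Ici (a := (0 : ℝ))).locallyCompactSpace
  inferInstance

/-- Space-time `ℝ^d × [0, ∞)`, with the product of the Lebesgue measures. -/
abbrev SpaceTime (d : ℕ) : Type := Space d × Time

/-! ### Test functions -/

/-- Test functions in `C¹_c(ℝ^d × [0, ∞))`. They are represented by a `C¹` extension with compact
support to `ℝ^d × ℝ`; such an extension always exists (reflect across `t = 0`), and only the values
at times `t ≥ 0` are ever used. No vanishing at `t = 0` is required. -/
structure IsTestFunction {d : ℕ} (φ : Space d × ℝ → ℝ) : Prop where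
  contDiff : ContDiff ℝ 1 φ
  compactSupport : HasCompactSupport φ

/-- The time derivative `∂ₜ φ (x, t)`. -/
def timeDeriv {d : ℕ} (φ : Space d × ℝ → ℝ) (x : Space d) (t : ℝ) : ℝ :=
  deriv (fun s : ℝ => φ (x, s)) t

/-- The spatial gradient `∇ₓ φ (x, t)`. -/
def spaceGrad {d : ℕ} (φ : Space d × ℝ → ℝ) (x : Space d) (t : ℝ) : Space d :=
  gradient (fun y : Space d => φ (y, t)) x

/-- The functional
`∫_{ℝ₊} ∫_{ℝ^d} ∂ₜφ a + ∇ₓφ · b dx dt + ∫_{ℝ^d} φ(x, 0) a₀(x) dx`,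
i.e. the distribution `-(∂ₜ a + ∇ₓ · b)` with initial value `a₀`, applied to `φ`. -/
def weakForm {d : ℕ} (a : SpaceTime d → ℝ) (b : SpaceTime d → Space d) (a₀ : Space d → ℝ)
    (φ : Space d × ℝ → ℝ) : ℝ :=
  (∫ t : Time, ∫ x : Space d,
      (timeDeriv φ x t * a (x, t) + inner ℝ (spaceGrad φ x t) (b (x, t))))
    + ∫ x : Space d, φ (x, 0) * a₀ x

/-! ### Entropy pairs and entropy solutions of the scalar conservation law -/

/-- `(η, q)` is an entropy pair for the flux `f`: `η` is convex and `q' = η' f'`. As `η` may have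
(countably many) kinks, the compatibility condition is stated in integrated form,
`q(b) - q(a) = ∫_a^b η'(ξ) f'(ξ) dξ`; for differentiable `η` and `C¹` flux this is `q' = η' f'`
at every point. -/
structure IsEntropyPair {d : ℕ} (f : ℝ → Space d) (η : ℝ → ℝ) (q : ℝ → Space d) : Prop where
  convex : ConvexOn ℝ univ η
  compat : ∀ a b : ℝ, q b - q a = ∫ ξ in a..b, deriv η ξ • deriv f ξ

/-- `u ∈ L^∞(ℝ^d × ℝ₊)` is a weak solution of `∂ₜ u + ∇ₓ · f(u) = 0`, `u(·, 0) = u₀ ∈ L^∞(ℝ^d)`. -/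
structure IsWeakSolution {d : ℕ} (f : ℝ → Space d) (u₀ : Space d → ℝ) (u : SpaceTime d → ℝ) :
    Prop where
  memLp_data : MemLp u₀ ⊤ volume
  memLp : MemLp u ⊤ volume
  weak_eq : ∀ φ : Space d × ℝ → ℝ, IsTestFunction φ →
    weakForm u (fun z => f (u z)) u₀ φ = 0

/-- Entropy solutions: weak solutions satisfying the entropy inequality for all entropy pairs. -/
structure IsEntropySolution {d : ℕ} (f : ℝ → Space d) (u₀ : Space d → ℝ) (u : SpaceTime d → ℝ) :
    Prop extends IsWeakSolution f u₀ u where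
  entropy_ineq : ∀ (η : ℝ → ℝ) (q : ℝ → Space d), IsEntropyPair f η q →
    ∀ φ : Space d × ℝ → ℝ, IsTestFunction φ → (∀ (x : Space d) (t : ℝ), 0 ≤ t → 0 ≤ φ (x, t)) →
      0 ≤ weakForm (fun z => η (u z)) (fun z => q (u z)) (fun x => η (u₀ x)) φ

/-! ### Young measures -/

/-- A Young measure from `Z` to `ℝ`: a weak* measurable map from `Z` to the probability measures
on `ℝ`. -/
structure YoungMeasure (Z : Type*) [MeasurableSpace Z] where
  toFun : Z → ProbabilityMeasure ℝ
  weakStarMeasurable : ∀ g : C₀(ℝ, ℝ), Measurable fun z => ∫ ξ, g ξ ∂(toFun z : Measure ℝ)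

namespace YoungMeasure

variable {Z : Type*} [MeasurableSpace Z]

/-- The probability measure `ν_z`. -/
def measureAt (ν : YoungMeasure Z) (z : Z) : Measure ℝ := (ν.toFun z : Measure ℝ)

/-- The pairing `⟨ν_z, g⟩ = ∫ g(ξ) dν_z(ξ)`. -/
def pair {F : Type*} [NormedAddCommGroup F] [NormedSpace ℝ F] (ν : YoungMeasure Z) (g : ℝ → F)
    (z : Z) : F :=
  ∫ ξ, g ξ ∂(ν.measureAt z)

/-- `ν` is uniformly bounded: all the measures `ν_z` are supported in one compact set. -/
def UniformlyBounded (ν : YoungMeasure Z) : Prop :=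
  ∃ K : Set ℝ, IsCompact K ∧ ∀ z : Z, (ν.measureAt z).support ⊆ K

/-- `⟨ν, g⟩` is a well defined, locally integrable function: `g` is `ν_z`-integrable for almost
every `z`, and `z ↦ ⟨ν_z, ‖g‖⟩` is locally integrable. -/
def PairingLocallyIntegrable {Z : Type*} [MeasureSpace Z] [TopologicalSpace Z]
    {F : Type*} [NormedAddCommGroup F] (ν : YoungMeasure Z) (g : ℝ → F) : Prop :=
  (∀ᵐ z : Z, Integrable g (ν.measureAt z)) ∧
    LocallyIntegrable (fun z : Z => ν.pair (fun ξ => ‖g ξ‖) z) volume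

/-- `ν` is the law of the random field `u` on `(Ω, P)`: `u` is jointly measurable and
`ν_z(F) = P(u(z) ∈ F)` for every `z` and every Borel set `F`. -/
def IsLawOf {Ω : Type*} [MeasurableSpace Ω] (P : Measure Ω) (u : Ω → Z → ℝ)
    (ν : YoungMeasure Z) : Prop :=
  Measurable (Function.uncurry u) ∧
    ∀ (z : Z) (F : Set ℝ), MeasurableSet F → ν.measureAt z F = P {ω | u ω z ∈ F}

end YoungMeasure

/-! ### Measure-valued solutions -/

/-- `ν` is a measure-valued solution of `∂ₜ⟨ν, id⟩ + ∇ₓ · ⟨ν, f⟩ = 0` with initial measure-valued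
data `σ`, in the sense of distributions (all pairings being well defined). -/
structure IsMVSolution {d : ℕ} (f : ℝ → Space d) (σ : YoungMeasure (Space d))
    (ν : YoungMeasure (SpaceTime d)) : Prop where
  integrable_id : ν.PairingLocallyIntegrable (fun ξ : ℝ => ξ)
  integrable_flux : ν.PairingLocallyIntegrable f
  integrable_data : σ.PairingLocallyIntegrable (fun ξ : ℝ => ξ)
  mv_eq : ∀ φ : Space d × ℝ → ℝ, IsTestFunction φ →
    weakForm (ν.pair fun ξ => ξ) (ν.pair f) (σ.pair fun ξ => ξ) φ = 0

/-- `ν` is an entropy measure-valued (EMV) solution with initial measure-valued data `σ`: a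
measure-valued solution with `∂ₜ⟨ν, η⟩ + ∇ₓ · ⟨ν, q⟩ ≤ 0` in the sense of distributions, including
the initial term, for every entropy pair (all pairings being well defined). -/
structure IsEMVSolution {d : ℕ} (f : ℝ → Space d) (σ : YoungMeasure (Space d))
    (ν : YoungMeasure (SpaceTime d)) : Prop extends IsMVSolution f σ ν where
  entropy_integrable : ∀ (η : ℝ → ℝ) (q : ℝ → Space d), IsEntropyPair f η q →
    ν.PairingLocallyIntegrable η ∧ ν.PairingLocallyIntegrable q ∧ σ.PairingLocallyIntegrable η
  entropy_ineq : ∀ (η : ℝ → ℝ) (q : ℝ → Space d), IsEntropyPair f η q →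
    ∀ φ : Space d × ℝ → ℝ, IsTestFunction φ → (∀ (x : Space d) (t : ℝ), 0 ≤ t → 0 ≤ φ (x, t)) →
      0 ≤ weakForm (ν.pair η) (ν.pair q) (σ.pair η) φ

end ScalarCL

end

/-!
The solution operator is built by Brenier's transport-collapse method, and no uniqueness theory is
needed. For values in `[a, b]`, a function `u` is encoded by its kinetic function `1_{ξ < u(x)}`,
`ξ ∈ (a, b]`. One time step `h` (`collapse`) transports this function freely with the velocities
`f'(ξ)` and then integrates it in `ξ`.

Two properties carry the proof. Free transport and averaging contract the `L¹` distance
(`wdist_collapse_le`, here with a weight that makes the whole space finite, so that data need not be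
integrable). And among all densities `0 ≤ g ≤ 1` of given mass, the kinetic function of a value
minimizes the integral against any nondecreasing `η'` (`integral_mul_step_le`), so that collapsing
decreases convex entropies. The latter yields a discrete entropy inequality (`approx_entropy_ineq`)
which involves only the derivative of the test function along characteristics, displaced by `O(h)`;
it passes to almost everywhere limits (`isEntropySolution_of_tendsto`).

Convergence: for Lipschitz data the approximations inherit the translation modulus of the data and
are Lipschitz in time, since the scheme commutes with translations and contracts. A diagonal
argument gives one sequence of time steps along which they converge for countably many dense data
at rational times, and by contraction the *same* sequence works for all bounded data at all times
(`exists_steps_tendsto`).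

This independence of the data gives the joint measurability. Realize `σ` as the law of a random
field `u₀` on the unit interval. The approximations for `u₀(ω; ·)` depend measurably on `ω`, and are
Cauchy in `L¹` of `Ω × space-time`, hence a subsequence converges for almost every `ω` almost
everywhere in space-time to a random field `u` (`exists_random_limit`). Averaging the weak
formulations over `ω`
shows that the law of `u` is an entropy measure-valued solution (`isEMVSolution_of_isLawOf`).
-/

namespace ScalarCL

open Filter Topology

/-! ### Kinetic representation of values and entropies -/

/-- The kinetic function `1_{ξ < v}` of the value `v`, as a function of the kinetic variable `ξ`. -/
noncomputable def step (ξ v : ℝ) : ℝ := if ξ < v then 1 else 0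

lemma step_nonneg (ξ v : ℝ) : 0 ≤ step ξ v := by unfold step; split_ifs <;> norm_num

lemma step_le_one (ξ v : ℝ) : step ξ v ≤ 1 := by unfold step; split_ifs <;> norm_num

lemma abs_step_le_one (ξ v : ℝ) : |step ξ v| ≤ 1 := by
  rw [abs_of_nonneg (step_nonneg ξ v)]; exact step_le_one ξ v

lemma step_mono {ξ v w : ℝ} (h : v ≤ w) : step ξ v ≤ step ξ w := by
  unfold step; split_ifs <;> grind

lemma measurable_step : Measurable fun z : ℝ × ℝ => step z.1 z.2 :=
  Measurable.ite (measurableSet_lt measurable_fst measurable_snd) measurable_const measurable_const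

lemma measurable_step_comp {α : Type*} [MeasurableSpace α] {ξ v : α → ℝ} (hξ : Measurable ξ)
    (hv : Measurable v) : Measurable fun z => step (ξ z) (v z) :=
  measurable_step.comp (hξ.prodMk hv)

lemma integrable_step_comp {a b : ℝ} {v : ℝ → ℝ} (hv : Measurable v) :
    Integrable (fun ξ => step ξ (v ξ)) (volume.restrict (Ioc a b)) :=
  Integrable.of_bound (measurable_step_comp measurable_id hv).aestronglyMeasurable 1
    (ae_of_all _ fun ξ => by simpa using abs_step_le_one ξ (v ξ))

/-- Multiplication by the kinetic function of `v` restricts integrals over `(a, b]` to `(a, v]`. -/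
lemma integral_step_smul {E : Type*} [NormedAddCommGroup E] [NormedSpace ℝ E] {a b v : ℝ}
    (hv : v ∈ Icc a b) (g : ℝ → E) :
    ∫ ξ in Ioc a b, step ξ v • g ξ = ∫ ξ in a..v, g ξ := by
  rw [intervalIntegral.integral_of_le hv.1, integral_Ioc_eq_integral_Ioo (y := v),
    ← integral_indicator measurableSet_Ioc, ← integral_indicator measurableSet_Ioo]
  congr 1
  ext ξ
  by_cases h1 : a < ξ <;> by_cases h2 : ξ < v
  · have : ξ ≤ b := h2.le.trans hv.2
    simp [indicator, step, *]
  all_goals simp [indicator, step, *]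

lemma integral_step {a b v : ℝ} (hv : v ∈ Icc a b) : ∫ ξ in Ioc a b, step ξ v = v - a := by
  simpa using integral_step_smul hv (fun _ => (1 : ℝ))

lemma lintegral_enorm_step_sub {a b u v : ℝ} (hu : u ∈ Icc a b) (hv : v ∈ Icc a b) :
    ∫⁻ ξ in Ioc a b, ‖step ξ u - step ξ v‖ₑ = ‖u - v‖ₑ := by
  wlog h : v ≤ u generalizing u v
  · have := this hv hu (le_of_not_ge h)
    rw [enorm_sub_rev, ← this]
    exact lintegral_congr fun ξ => enorm_sub_rev _ _
  have h0 : ∀ ξ, 0 ≤ step ξ u - step ξ v := fun ξ => sub_nonneg.2 (step_mono h)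
  have hi : ∀ w : ℝ, Integrable (fun ξ => step ξ w) (volume.restrict (Ioc a b)) :=
    fun w => integrable_step_comp measurable_const
  have := ofReal_integral_eq_lintegral_ofReal ((hi u).sub (hi v)) (ae_of_all _ h0)
  simp only [Pi.sub_apply] at this
  rw [integral_sub (hi u) (hi v), integral_step hu, integral_step hv] at this
  rw [Real.enorm_of_nonneg (sub_nonneg.2 h), show u - v = u - a - (v - a) by ring, this]
  exact lintegral_congr fun ξ => Real.enorm_of_nonneg (h0 ξ)

/-- Among all kinetic densities `0 ≤ g ≤ 1` with prescribed integral, the one of a value, which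
sits on the smallest `ξ`, minimizes the integral against a nondecreasing weight. This is the reason
why collapsing decreases convex entropies. -/
lemma integral_mul_step_le {a b : ℝ} (hab : a ≤ b) {p g : ℝ → ℝ} (hp : Monotone p)
    (hg : Measurable g) (hg0 : ∀ ξ, 0 ≤ g ξ) (hg1 : ∀ ξ, g ξ ≤ 1) :
    ∫ ξ in Ioc a b, p ξ * step ξ (a + ∫ ξ in Ioc a b, g ξ) ≤ ∫ ξ in Ioc a b, p ξ * g ξ := by
  set U := a + ∫ ξ in Ioc a b, g ξ with hU
  have hgi : Integrable g (volume.restrict (Ioc a b)) :=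
    Integrable.of_bound hg.aestronglyMeasurable 1
      (ae_of_all _ fun ξ => by rw [Real.norm_of_nonneg (hg0 ξ)]; exact hg1 ξ)
  have hUm : U ∈ Icc a b := by
    have h0 : 0 ≤ ∫ ξ in Ioc a b, g ξ := integral_nonneg hg0
    have h1 : ∫ ξ in Ioc a b, g ξ ≤ ∫ ξ in Ioc a b, (1 : ℝ) :=
      integral_mono hgi (integrable_const _) hg1
    simp [hab] at h1
    constructor <;> linarith
  have hpi : Integrable p (volume.restrict (Ioc a b)) :=
    (hp.locallyIntegrable.integrableOn_isCompact isCompact_Icc).mono_set Ioc_subset_Icc_self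
  have hsi : Integrable (fun ξ => step ξ U) (volume.restrict (Ioc a b)) :=
    integrable_step_comp measurable_const
  have hps : Integrable (fun ξ => p ξ * step ξ U) (volume.restrict (Ioc a b)) :=
    hpi.mul_bdd (c := 1) hsi.aestronglyMeasurable
      (ae_of_all _ fun ξ => by simpa using abs_step_le_one ξ U)
  have hpg : Integrable (fun ξ => p ξ * g ξ) (volume.restrict (Ioc a b)) :=
    hpi.mul_bdd (c := 1) hgi.aestronglyMeasurable
      (ae_of_all _ fun ξ => by rw [Real.norm_of_nonneg (hg0 ξ)]; exact hg1 ξ)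
  have h1 : ∫ ξ in Ioc a b, p U * step ξ U = ∫ ξ in Ioc a b, p U * g ξ := by
    rw [integral_const_mul, integral_const_mul, integral_step hUm, hU]; ring
  have h2 : ∫ ξ in Ioc a b, (p ξ * step ξ U - p U * step ξ U)
      ≤ ∫ ξ in Ioc a b, (p ξ * g ξ - p U * g ξ) := by
    refine integral_mono (hps.sub (hsi.const_mul _)) (hpg.sub (hgi.const_mul _)) fun ξ => ?_
    rcases lt_or_ge ξ U with h | h
    · have := hp h.le
      simp only [step, h, if_true]
      nlinarith [hg1 ξ]
    · have := hp h
      simp only [step, not_lt.2 h, if_false]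
      nlinarith [hg0 ξ]
  rw [integral_sub hps (hsi.const_mul _), integral_sub hpg (hgi.const_mul _), h1] at h2
  linarith

/-- A convex function on the line is the primitive of its right derivative, a nondecreasing
function which agrees with the derivative off a countable set. -/
lemma exists_monotone_primitive {η : ℝ → ℝ} (hη : ConvexOn ℝ univ η) :
    ∃ p : ℝ → ℝ, Monotone p ∧ deriv η =ᵐ[volume] p ∧ ∀ x y, η y - η x = ∫ ξ in x..y, p ξ := by
  have hcont : Continuous η := by
    rw [← continuousOn_univ]; exact hη.continuousOn isOpen_univ
  have hmono : Monotone fun x => derivWithin η (Ioi x) x := by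
    have := hη.monotoneOn_rightDeriv
    rwa [interior_univ, monotoneOn_univ] at this
  have hint : ∀ x y, η y - η x = ∫ ξ in x..y, derivWithin η (Ioi ξ) ξ := by
    intro x y
    refine (intervalIntegral.integral_eq_sub_of_hasDeriv_right hcont.continuousOn
      (fun ξ _ => ?_) hmono.intervalIntegrable).symm
    exact hη.hasDerivWithinAt_rightDeriv_of_mem_interior (by simp)
  refine ⟨_, hmono, ?_, hint⟩
  have hc := hmono.countable_not_continuousAt
  refine (hc.ae_notMem volume).mono fun x hx => ?_
  have hx' : ContinuousAt (fun x => derivWithin η (Ioi x) x) x := by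
    by_contra h; exact hx h
  have hd : HasDerivAt (fun y => ∫ ξ in x..y, derivWithin η (Ioi ξ) ξ)
      (derivWithin η (Ioi x) x) x :=
    intervalIntegral.integral_hasDerivAt_right hmono.intervalIntegrable
      (hmono.measurable.stronglyMeasurable.stronglyMeasurableAtFilter) hx'
  have : η = fun y => η x + ∫ ξ in x..y, derivWithin η (Ioi ξ) ξ := by
    ext y; rw [← hint]; ring
  have h2 := (hd.const_add (η x)).deriv
  rw [← this] at h2
  exact h2

lemma abs_le_of_monotone {p : ℝ → ℝ} (hp : Monotone p) {a b ξ : ℝ} (h : ξ ∈ Icc a b) :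
    |p ξ| ≤ |p a| + |p b| := by
  have h1 := hp h.1
  have h2 := hp h.2
  rw [abs_le]
  constructor <;> cases abs_cases (p a) <;> cases abs_cases (p b) <;> linarith

/-- Kinetic representation of an entropy pair, with a nondecreasing `p` in the role of `η'`. -/
lemma IsEntropyPair.exists_kinetic {d : ℕ} {f : ℝ → Space d} {η : ℝ → ℝ} {q : ℝ → Space d}
    (h : IsEntropyPair f η q) :
    ∃ p : ℝ → ℝ, Monotone p ∧ ∀ a b v : ℝ, v ∈ Icc a b →
      (η v - η a = ∫ ξ in Ioc a b, p ξ * step ξ v) ∧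
      (q v - q a = ∫ ξ in Ioc a b, (p ξ * step ξ v) • deriv f ξ) := by
  obtain ⟨p, hp, hae, hint⟩ := exists_monotone_primitive h.convex
  refine ⟨p, hp, fun a b v hv => ⟨?_, ?_⟩⟩
  · rw [hint, ← integral_step_smul hv p]
    simp only [smul_eq_mul, mul_comm]
  · rw [h.compat, ← integral_step_smul hv]
    refine integral_congr_ae (ae_restrict_of_ae (hae.mono fun ξ hξ => ?_))
    simp only [hξ, smul_smul, mul_comm]

lemma IsEntropyPair.continuous_entropy {d : ℕ} {f : ℝ → Space d} {η : ℝ → ℝ} {q : ℝ → Space d}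
    (h : IsEntropyPair f η q) : Continuous η := by
  rw [← continuousOn_univ]; exact h.convex.continuousOn isOpen_univ

lemma IsEntropyPair.continuous_flux {d : ℕ} {f : ℝ → Space d} (hf : ContDiff ℝ 1 f) {η : ℝ → ℝ}
    {q : ℝ → Space d} (h : IsEntropyPair f η q) : Continuous q := by
  obtain ⟨p, hp, hae, -⟩ := exists_monotone_primitive h.convex
  have hi : ∀ x y, IntervalIntegrable (fun ξ => deriv η ξ • deriv f ξ) volume x y := by
    intro x y
    have h1 : IntervalIntegrable (fun ξ => p ξ • deriv f ξ) volume x y :=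
      hp.intervalIntegrable.smul_continuousOn (hf.continuous_deriv le_rfl).continuousOn
    refine h1.congr_ae (ae_restrict_of_ae (hae.mono fun ξ hξ => ?_))
    simp only [hξ]
  have : q = fun v => q 0 + ∫ ξ in (0 : ℝ)..v, deriv η ξ • deriv f ξ := by
    ext1 v; rw [← h.compat]; abel
  rw [this]
  exact continuous_const.add (intervalIntegral.continuous_primitive hi 0)

/-! ### A weighted `L¹` distance -/

/-- A finite measure on space, equivalent to Lebesgue measure, which changes by at most a factor
`exp ((d + 1) ‖z‖)` under the translation by `z`. -/
noncomputable def weight (d : ℕ) : Measure (Space d) :=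
  volume.withDensity fun x => ENNReal.ofReal ((1 + ‖x‖) ^ (-((d + 1 : ℕ) : ℝ)))

lemma measurable_weight_density (d : ℕ) : Measurable
    fun x : Space d => ENNReal.ofReal ((1 + ‖x‖) ^ (-((d + 1 : ℕ) : ℝ))) := by
  fun_prop

instance (d : ℕ) : IsFiniteMeasure (weight d) := by
  refine isFiniteMeasure_withDensity_ofReal ?_
  exact (integrable_one_add_norm (by simp)).2

lemma absolutelyContinuous_weight (d : ℕ) : (volume : Measure (Space d)) ≪ weight d := by
  refine withDensity_absolutelyContinuous' (measurable_weight_density d).aemeasurable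
    (ae_of_all _ fun x => ?_)
  have : 0 < (1 + ‖x‖) ^ (-((d + 1 : ℕ) : ℝ)) := Real.rpow_pos_of_pos (by positivity) _
  simpa using this

lemma weight_density_sub_le {d : ℕ} (x z : Space d) :
    (1 + ‖x - z‖) ^ (-((d + 1 : ℕ) : ℝ)) ≤
      Real.exp ((d + 1) * ‖z‖) * (1 + ‖x‖) ^ (-((d + 1 : ℕ) : ℝ)) := by
  have h1 : 1 + ‖x‖ ≤ Real.exp ‖z‖ * (1 + ‖x - z‖) := by
    have h2 : ‖x‖ ≤ ‖x - z‖ + ‖z‖ := by simpa using norm_add_le (x - z) z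
    have h3 := Real.add_one_le_exp ‖z‖
    nlinarith [norm_nonneg z, norm_nonneg (x - z), norm_nonneg x]
  rw [Real.rpow_neg (by positivity), Real.rpow_neg (by positivity), Real.rpow_natCast,
    Real.rpow_natCast, ← div_eq_mul_inv, inv_le_comm₀ (by positivity) (by positivity), inv_div,
    div_le_iff₀ (by positivity)]
  calc (1 + ‖x‖) ^ (d + 1) ≤ (Real.exp ‖z‖ * (1 + ‖x - z‖)) ^ (d + 1) := by gcongr
    _ = (1 + ‖x - z‖) ^ (d + 1) * Real.exp ((d + 1) * ‖z‖) := by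
      rw [mul_pow, ← Real.exp_nat_mul, mul_comm]; push_cast; rfl

lemma lintegral_weight_comp_add_le {d : ℕ} {F : Space d → ENNReal} (hF : Measurable F)
    (z : Space d) : ∫⁻ x, F (x + z) ∂(weight d) ≤
      ENNReal.ofReal (Real.exp ((d + 1) * ‖z‖)) * ∫⁻ x, F x ∂(weight d) := by
  unfold weight
  rw [lintegral_withDensity_eq_lintegral_mul _ (measurable_weight_density d)
      (show Measurable fun x => F (x + z) from hF.comp (measurable_add_const z)),
    lintegral_withDensity_eq_lintegral_mul _ (measurable_weight_density d) hF,
    ← lintegral_const_mul _ ((measurable_weight_density d).mul hF),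
    ← lintegral_sub_right_eq_self _ z]
  refine lintegral_mono fun x => ?_
  simp only [Pi.mul_apply, sub_add_cancel, ← mul_assoc]
  rw [← ENNReal.ofReal_mul (Real.exp_nonneg _)]
  gcongr
  exact weight_density_sub_le x z

/-- The weighted `L¹` distance of two functions on space. -/
noncomputable def wdist {d : ℕ} (u v : Space d → ℝ) : ENNReal := ∫⁻ x, ‖u x - v x‖ₑ ∂(weight d)

lemma wdist_comm {d : ℕ} (u v : Space d → ℝ) : wdist u v = wdist v u :=
  lintegral_congr fun _ => enorm_sub_rev _ _

lemma wdist_triangle {d : ℕ} {u v w : Space d → ℝ} (hu : Measurable u) (hv : Measurable v) :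
    wdist u w ≤ wdist u v + wdist v w := by
  unfold wdist
  rw [← lintegral_add_left (show Measurable fun x => ‖u x - v x‖ₑ from (hu.sub hv).enorm)]
  exact lintegral_mono fun x => by
    simpa using enorm_add_le (u x - v x) (v x - w x)

lemma wdist_le_of_forall {d : ℕ} {u v : Space d → ℝ} {C : ℝ} (h : ∀ x, |u x - v x| ≤ C) :
    wdist u v ≤ ENNReal.ofReal C * weight d univ := by
  calc wdist u v ≤ ∫⁻ _, ENNReal.ofReal C ∂(weight d) := lintegral_mono fun x => by
        rw [← ofReal_norm]; exact ENNReal.ofReal_le_ofReal (h x)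
    _ = _ := lintegral_const _

/-- Measurable functions on space with values in `[a, b]`. -/
structure Admissible {d : ℕ} (a b : ℝ) (u : Space d → ℝ) : Prop where
  measurable : Measurable u
  mem : ∀ x, u x ∈ Icc a b

lemma Admissible.translate {d : ℕ} {a b : ℝ} {u : Space d → ℝ} (hu : Admissible a b u)
    (z : Space d) : Admissible a b fun x => u (x + z) :=
  ⟨hu.measurable.comp (measurable_add_const z), fun _ => hu.mem _⟩

lemma abs_sub_le_of_mem_Icc {a b u v : ℝ} (hu : u ∈ Icc a b) (hv : v ∈ Icc a b) :
    |u - v| ≤ b - a := by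
  rw [abs_le]; constructor <;> linarith [hu.1, hu.2, hv.1, hv.2]

/-! ### The transport-collapse operator -/

/-- The transport-collapse operator with time step `h`: the kinetic function `1_{ξ < u(x)}` of `u`
is transported freely with velocities `c ξ` during the time `h`, and then averaged over
`ξ ∈ (a, b]`. -/
noncomputable def collapse {d : ℕ} (c : ℝ → Space d) (a b h : ℝ) (u : Space d → ℝ) (x : Space d) :
    ℝ :=
  a + ∫ ξ in Ioc a b, step ξ (u (x - h • c ξ))

/-- The approximate solution with time step `h` and initial data `u`, constant on the time intervals
`[n h, (n + 1) h)`. -/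
noncomputable def approx {d : ℕ} (c : ℝ → Space d) (a b h : ℝ) (u : Space d → ℝ) (t : ℝ) :
    Space d → ℝ :=
  (collapse c a b h)^[⌊t / h⌋₊] u

section

variable {d : ℕ} {c : ℝ → Space d} {a b h L : ℝ}

lemma measurable_collapse_param {Ω : Type*} [MeasurableSpace Ω] (hc : Measurable c)
    {u : Ω → Space d → ℝ} (hu : Measurable (Function.uncurry u)) :
    Measurable (Function.uncurry fun ω => collapse c a b h (u ω)) := by
  have h1 : Measurable fun z : (Ω × Space d) × ℝ => step z.2 (u z.1.1 (z.1.2 - h • c z.2)) := by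
    refine measurable_step_comp measurable_snd ?_
    exact hu.comp ((measurable_fst.comp measurable_fst).prodMk
      ((measurable_snd.comp measurable_fst).sub ((hc.comp measurable_snd).const_smul h)))
  exact (h1.stronglyMeasurable.integral_prod_right
    (ν := volume.restrict (Ioc a b))).measurable.const_add a

lemma measurable_collapse (hc : Measurable c) {u : Space d → ℝ} (hu : Measurable u) :
    Measurable (collapse c a b h u) :=
  (measurable_collapse_param (Ω := Unit) hc (u := fun _ => u)
    (hu.comp measurable_snd)).comp
    (measurable_const.prodMk measurable_id : Measurable fun x => ((), x))

lemma integrable_step_transport (hc : Measurable c) {u : Space d → ℝ} (hu : Measurable u)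
    (x : Space d) :
    Integrable (fun ξ => step ξ (u (x - h • c ξ))) (volume.restrict (Ioc a b)) :=
  integrable_step_comp (hu.comp (measurable_const.sub (hc.const_smul h)))

lemma Admissible.collapse (hab : a ≤ b) (hc : Measurable c) {u : Space d → ℝ}
    (hu : Admissible a b u) : Admissible a b (collapse c a b h u) := by
  refine ⟨measurable_collapse hc hu.measurable, fun x => ?_⟩
  have h0 : 0 ≤ ∫ ξ in Ioc a b, step ξ (u (x - h • c ξ)) :=
    integral_nonneg fun ξ => step_nonneg _ _
  have h1 : ∫ ξ in Ioc a b, step ξ (u (x - h • c ξ)) ≤ ∫ ξ in Ioc a b, (1 : ℝ) :=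
    integral_mono (integrable_step_transport hc hu.measurable x) (integrable_const _)
      fun ξ => step_le_one _ _
  simp [hab] at h1
  constructor <;> unfold ScalarCL.collapse <;> linarith

lemma Admissible.iterate (hab : a ≤ b) (hc : Measurable c) {u : Space d → ℝ}
    (hu : Admissible a b u) (n : ℕ) : Admissible a b ((ScalarCL.collapse c a b h)^[n] u) := by
  induction n with
  | zero => exact hu
  | succ n ih => rw [Function.iterate_succ_apply']; exact ih.collapse hab hc

lemma Admissible.approx (hab : a ≤ b) (hc : Measurable c) {u : Space d → ℝ}
    (hu : Admissible a b u) (t : ℝ) : Admissible a b (approx c a b h u t) :=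
  hu.iterate hab hc _

lemma measurable_approx_param {Ω : Type*} [MeasurableSpace Ω] (hc : Measurable c)
    {u : Ω → Space d → ℝ} (hu : Measurable (Function.uncurry u)) :
    Measurable fun z : Ω × Space d × ℝ => approx c a b h (u z.1) z.2.2 z.2.1 := by
  have h1 : ∀ n : ℕ, Measurable
      (Function.uncurry fun ω => (collapse c a b h)^[n] (u ω)) := by
    intro n
    induction n with
    | zero => exact hu
    | succ n ih =>
      simp only [Function.iterate_succ_apply']
      exact measurable_collapse_param hc ih
  have h2 : Measurable fun z : (Ω × Space d) × ℕ =>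
      (collapse c a b h)^[z.2] (u z.1.1) z.1.2 :=
    measurable_from_prod_countable_left h1
  have h3 : Measurable fun z : Ω × Space d × ℝ => ((z.1, z.2.1), ⌊z.2.2 / h⌋₊) := by
    refine (measurable_fst.prodMk (measurable_fst.comp measurable_snd)).prodMk ?_
    exact Nat.measurable_floor.comp ((measurable_snd.comp measurable_snd).div_const h)
  exact h2.comp h3

lemma collapse_translate (u : Space d → ℝ) (z : Space d) :
    collapse c a b h (fun x => u (x + z)) = fun x => collapse c a b h u (x + z) := by
  ext x; simp only [collapse, sub_add_eq_add_sub]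

lemma iterate_collapse_translate (u : Space d → ℝ) (z : Space d) (n : ℕ) :
    (collapse c a b h)^[n] (fun x => u (x + z)) = fun x => (collapse c a b h)^[n] u (x + z) := by
  induction n with
  | zero => rfl
  | succ n ih => simp only [Function.iterate_succ_apply', ih, collapse_translate]

/-- Free transport preserves the `L¹` distance of the kinetic functions up to the growth of the
weight, and averaging does not increase it. -/
lemma wdist_collapse_le (hc : Measurable c) (hL : ∀ ξ ∈ Icc a b, ‖c ξ‖ ≤ L) (hh : 0 ≤ h)
    {u v : Space d → ℝ} (hu : Admissible a b u) (hv : Admissible a b v) :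
    wdist (collapse c a b h u) (collapse c a b h v) ≤
      ENNReal.ofReal (Real.exp ((d + 1) * L * h)) * wdist u v := by
  have hm : Measurable fun z : Space d × ℝ => ‖step z.2 (u z.1) - step z.2 (v z.1)‖ₑ :=
    ((measurable_step_comp measurable_snd (hu.measurable.comp measurable_fst)).sub
      (measurable_step_comp measurable_snd (hv.measurable.comp measurable_fst))).enorm
  have ht : Measurable fun z : Space d × ℝ => (z.1 + (-(h • c z.2)), z.2) :=
    (measurable_fst.add ((hc.comp measurable_snd).const_smul h).neg).prodMk measurable_snd
  have hm' : Measurable fun z : Space d × ℝ =>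
      ‖step z.2 (u (z.1 + (-(h • c z.2)))) - step z.2 (v (z.1 + (-(h • c z.2))))‖ₑ :=
    hm.comp ht
  calc wdist (collapse c a b h u) (collapse c a b h v)
      ≤ ∫⁻ x, (∫⁻ ξ in Ioc a b, ‖step ξ (u (x + (-(h • c ξ))))
          - step ξ (v (x + (-(h • c ξ))))‖ₑ) ∂(weight d) := by
        refine lintegral_mono fun x => ?_
        simp only [← sub_eq_add_neg]
        rw [collapse, collapse, add_sub_add_left_eq_sub,
          ← integral_sub (integrable_step_transport hc hu.measurable x)
            (integrable_step_transport hc hv.measurable x)]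
        exact enorm_integral_le_lintegral_enorm _
    _ = ∫⁻ ξ in Ioc a b, ∫⁻ x, ‖step ξ (u (x + (-(h • c ξ))))
          - step ξ (v (x + (-(h • c ξ))))‖ₑ ∂(weight d) :=
        lintegral_lintegral_swap hm'.aemeasurable
    _ ≤ ∫⁻ ξ in Ioc a b, ENNReal.ofReal (Real.exp ((d + 1) * L * h)) *
          ∫⁻ x, ‖step ξ (u x) - step ξ (v x)‖ₑ ∂(weight d) := by
        refine setLIntegral_mono' measurableSet_Ioc fun ξ hξ => ?_
        refine (lintegral_weight_comp_add_le (hm.comp (measurable_prodMk_right)) _).trans ?_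
        gcongr ENNReal.ofReal (Real.exp ?_) * ?_
        · rw [norm_neg, norm_smul, Real.norm_of_nonneg hh, mul_assoc, mul_comm L]
          have := hL ξ (Ioc_subset_Icc_self hξ)
          gcongr
        · rfl
    _ = ENNReal.ofReal (Real.exp ((d + 1) * L * h)) *
          ∫⁻ x, (∫⁻ ξ in Ioc a b, ‖step ξ (u x) - step ξ (v x)‖ₑ) ∂(weight d) := by
        rw [lintegral_const_mul _ hm.lintegral_prod_left', ← lintegral_lintegral_swap
            (f := fun x ξ => ‖step ξ (u x) - step ξ (v x)‖ₑ) hm.aemeasurable]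
    _ = _ := by
        congr 1
        exact lintegral_congr fun x => lintegral_enorm_step_sub (hu.mem x) (hv.mem x)

lemma wdist_iterate_le (hab : a ≤ b) (hc : Measurable c) (hL : ∀ ξ ∈ Icc a b, ‖c ξ‖ ≤ L)
    (hh : 0 ≤ h) {u v : Space d → ℝ} (hu : Admissible a b u) (hv : Admissible a b v) (n : ℕ) :
    wdist ((collapse c a b h)^[n] u) ((collapse c a b h)^[n] v) ≤
      ENNReal.ofReal (Real.exp ((d + 1) * L * (n * h))) * wdist u v := by
  induction n with
  | zero => simp
  | succ n ih =>
    simp only [Function.iterate_succ_apply']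
    refine (wdist_collapse_le hc hL hh (hu.iterate hab hc n) (hv.iterate hab hc n)).trans ?_
    refine (mul_le_mul_right ih _).trans (le_of_eq ?_)
    rw [← mul_assoc, ← ENNReal.ofReal_mul (Real.exp_nonneg _), ← Real.exp_add]
    congr 3
    push_cast; ring

lemma floor_div_mul_le {t : ℝ} (hh : 0 < h) (ht : 0 ≤ t) : (⌊t / h⌋₊ : ℝ) * h ≤ t :=
  (le_div_iff₀ hh).1 (Nat.floor_le (by positivity))

lemma wdist_approx_le (hab : a ≤ b) (hc : Measurable c) (hL0 : 0 ≤ L)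
    (hL : ∀ ξ ∈ Icc a b, ‖c ξ‖ ≤ L)
    (hh : 0 < h) {u v : Space d → ℝ} (hu : Admissible a b u) (hv : Admissible a b v) {t : ℝ}
    (ht : 0 ≤ t) : wdist (approx c a b h u t) (approx c a b h v t) ≤
      ENNReal.ofReal (Real.exp ((d + 1) * L * t)) * wdist u v := by
  refine (wdist_iterate_le hab hc hL hh.le hu hv _).trans ?_
  gcongr
  exact floor_div_mul_le hh ht

lemma wdist_approx_translate_le (hab : a ≤ b) (hc : Measurable c) (hL0 : 0 ≤ L)
    (hL : ∀ ξ ∈ Icc a b, ‖c ξ‖ ≤ L)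
    (hh : 0 < h) {u : Space d → ℝ} (hu : Admissible a b u) {t : ℝ} (ht : 0 ≤ t) (z : Space d) :
    wdist (fun x => approx c a b h u t (x + z)) (approx c a b h u t) ≤
      ENNReal.ofReal (Real.exp ((d + 1) * L * t)) * wdist (fun x => u (x + z)) u := by
  have := wdist_approx_le hab hc hL0 hL hh (hu.translate z) hu ht
  rwa [approx, iterate_collapse_translate] at this

/-- By monotonicity, one time step changes Lipschitz data pointwise by at most `O(h)`. -/
lemma abs_collapse_sub_le (hc : Measurable c) (hL : ∀ ξ ∈ Icc a b, ‖c ξ‖ ≤ L)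
    (hh : 0 ≤ h) {u : Space d → ℝ} (hu : Admissible a b u) {K : NNReal} (hK : LipschitzWith K u)
    (x : Space d) : |collapse c a b h u x - u x| ≤ K * L * h := by
  have hd : ∀ ξ ∈ Ioc a b, |u (x - h • c ξ) - u x| ≤ K * L * h := by
    intro ξ hξ
    have h1 := hK.dist_le_mul (x - h • c ξ) x
    rw [Real.dist_eq, dist_eq_norm, sub_sub_cancel_left, norm_neg, norm_smul,
      Real.norm_of_nonneg hh] at h1
    refine h1.trans ?_
    rw [mul_assoc, mul_comm L]
    have := hL ξ (Ioc_subset_Icc_self hξ)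
    gcongr
  have hi := integrable_step_transport (h := h) (a := a) (b := b) hc hu.measurable x
  have hs : ∀ w : ℝ, Integrable (fun ξ => step ξ w) (volume.restrict (Ioc a b)) :=
    fun w => integrable_step_comp measurable_const
  have hx := hu.mem x
  -- Comparison with the constants `u x ± K L h`, cut off at `a` and `b`.
  by_cases hemp : ∃ ξ, ξ ∈ Ioc a b
  · obtain ⟨ξ₀, hξ₀⟩ := hemp
    have hpos : 0 ≤ K * L * h := (abs_nonneg _).trans (hd ξ₀ hξ₀)
    have hab : a ≤ b := hx.1.trans hx.2
    have up : ∫ ξ in Ioc a b, step ξ (u (x - h • c ξ)) ≤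
        ∫ ξ in Ioc a b, step ξ (min b (u x + K * L * h)) := by
      refine setIntegral_mono_on hi (hs _) measurableSet_Ioc fun ξ hξ => step_mono (le_min ?_ ?_)
      · exact (hu.mem _).2
      · have := (abs_le.1 (hd ξ hξ)).2; linarith
    have lo : ∫ ξ in Ioc a b, step ξ (max a (u x - K * L * h)) ≤
        ∫ ξ in Ioc a b, step ξ (u (x - h • c ξ)) := by
      refine setIntegral_mono_on (hs _) hi measurableSet_Ioc fun ξ hξ => step_mono (max_le ?_ ?_)
      · exact (hu.mem _).1
      · have := (abs_le.1 (hd ξ hξ)).1; linarith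
    rw [integral_step ⟨le_min hab (by linarith [hx.1]), min_le_left _ _⟩] at up
    rw [integral_step ⟨le_max_left _ _, max_le hab (by linarith [hx.2])⟩] at lo
    have h1 := min_le_right b (u x + K * L * h)
    have h2 := le_max_right a (u x - K * L * h)
    rw [abs_le]
    constructor <;> unfold collapse <;> linarith
  · have hab : a = b := by
      refine le_antisymm (hx.1.trans hx.2) (not_lt.1 fun hlt => hemp ⟨b, hlt, le_rfl⟩)
    have hL0 : 0 ≤ L := (norm_nonneg _).trans (hL (u x) hx)
    have : u x = a := le_antisymm (hab ▸ hx.2) hx.1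
    subst hab
    simp [collapse, this]
    positivity

/-- By contraction, later time steps change the solution, up to the growth of the weight, by no more
than the first one. -/
lemma wdist_iterate_add_le (hab : a ≤ b) (hc : Measurable c) (hL0 : 0 ≤ L)
    (hL : ∀ ξ ∈ Icc a b, ‖c ξ‖ ≤ L)
    (hh : 0 ≤ h) {u : Space d → ℝ} (hu : Admissible a b u) {K : NNReal} (hK : LipschitzWith K u)
    (n j : ℕ) : wdist ((collapse c a b h)^[n] u) ((collapse c a b h)^[n + j] u) ≤
      ENNReal.ofReal (Real.exp ((d + 1) * L * ((n + j : ℕ) * h)) * (K * L * (j * h)))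
        * weight d univ := by
  have hstep : ∀ m : ℕ, wdist ((collapse c a b h)^[m] u) ((collapse c a b h)^[m + 1] u) ≤
      ENNReal.ofReal (Real.exp ((d + 1) * L * (m * h)) * (K * L * h)) * weight d univ := by
    intro m
    rw [Function.iterate_succ_apply]
    refine (wdist_iterate_le hab hc hL hh hu (hu.collapse hab hc) m).trans ?_
    rw [ENNReal.ofReal_mul (Real.exp_nonneg _), mul_assoc (ENNReal.ofReal _)]
    gcongr ENNReal.ofReal _ * ?_
    refine wdist_le_of_forall fun x => ?_
    rw [abs_sub_comm]
    exact abs_collapse_sub_le hc hL hh hu hK x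
  induction j with
  | zero => simp [wdist]
  | succ j ih =>
    have hm := fun k => (hu.iterate (h := h) hab hc k).measurable
    refine (wdist_triangle (hm n) (hm (n + j))).trans ?_
    refine (add_le_add ih (hstep (n + j))).trans ?_
    rw [← add_mul, ← ENNReal.ofReal_add (by positivity) (by positivity)]
    gcongr
    have hle : Real.exp ((d + 1) * L * ((n + j : ℕ) * h)) ≤
        Real.exp ((d + 1) * L * ((n + (j + 1) : ℕ) * h)) := by
      gcongr; omega
    have hp : 0 ≤ K * L * h := by positivity
    push_cast at hle ⊢
    nlinarith [mul_nonneg hp (Nat.cast_nonneg (α := ℝ) j),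
      mul_le_mul_of_nonneg_right hle hp,
      mul_le_mul_of_nonneg_right hle (mul_nonneg hp (Nat.cast_nonneg (α := ℝ) j))]

/-- For Lipschitz data, the approximate solutions are Lipschitz in time, up to the time step. -/
lemma wdist_approx_time_le (hab : a ≤ b) (hc : Measurable c) (hL0 : 0 ≤ L)
    (hL : ∀ ξ ∈ Icc a b, ‖c ξ‖ ≤ L)
    (hh : 0 < h) {u : Space d → ℝ} (hu : Admissible a b u) {K : NNReal} (hK : LipschitzWith K u)
    {s t : ℝ} (hs : 0 ≤ s) (hst : s ≤ t) :
    wdist (approx c a b h u s) (approx c a b h u t) ≤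
      ENNReal.ofReal (Real.exp ((d + 1) * L * t) * (K * L * (t - s + h))) * weight d univ := by
  obtain ⟨j, hj⟩ := Nat.exists_eq_add_of_le
    (Nat.floor_mono (by gcongr : s / h ≤ t / h))
  have h1 := wdist_iterate_add_le hab hc hL0 hL hh.le hu hK ⌊s / h⌋₊ j
  rw [← hj] at h1
  refine h1.trans ?_
  have h2 := floor_div_mul_le hh (hs.trans hst)
  have h3 : s < (⌊s / h⌋₊ + 1) * h := (div_lt_iff₀ hh).1 (Nat.lt_floor_add_one _)
  have h4 : (j : ℝ) * h ≤ t - s + h := by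
    rw [hj] at h2; push_cast at h2; nlinarith
  have h5 : 0 ≤ t - s + h := le_trans (by positivity) h4
  gcongr

end

/-! ### Strong compactness of the approximate solutions -/

lemma exists_dense_integrable (d : ℕ) : ∃ g : ℕ → Space d → ℝ, (∀ j, Integrable (g j)) ∧
    ∀ G : Space d → ℝ, Integrable G → ∀ ε > 0, ∃ j, ∫ x, |G x - g j x| ≤ ε := by
  have : Fact ((1 : ENNReal) ≠ ⊤) := ⟨ENNReal.one_ne_top⟩
  refine ⟨fun j => TopologicalSpace.denseSeq (Lp ℝ 1 (volume : Measure (Space d))) j,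
    fun j => L1.integrable_coeFn _, fun G hG ε hε => ?_⟩
  obtain ⟨j, hj⟩ := (TopologicalSpace.denseRange_denseSeq
    (Lp ℝ 1 (volume : Measure (Space d)))).exists_dist_lt (hG.toL1 G) hε
  refine ⟨j, ?_⟩
  rw [dist_eq_norm, L1.norm_eq_integral_norm] at hj
  refine le_trans (le_of_eq (integral_congr_ae ?_)) hj.le
  filter_upwards [Lp.coeFn_sub (hG.toL1 G) (TopologicalSpace.denseSeq
    (Lp ℝ 1 (volume : Measure (Space d))) j), hG.coeFn_toL1] with x h1 h2
  rw [h1, Pi.sub_apply, h2, Real.norm_eq_abs]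

lemma Admissible.memLp {d : ℕ} {a b : ℝ} {u : Space d → ℝ} (hu : Admissible a b u) (p : ENNReal) :
    MemLp u p (weight d) :=
  MemLp.of_bound hu.measurable.aestronglyMeasurable (|a| + |b|) (ae_of_all _ fun x =>
    abs_le_of_monotone monotone_id (hu.mem x))

lemma edist_toLp_eq_wdist {d : ℕ} {u v : Space d → ℝ} (hu : MemLp u 1 (weight d))
    (hv : MemLp v 1 (weight d)) : edist (hu.toLp u) (hv.toLp v) = wdist u v := by
  rw [Lp.edist_toLp_toLp, eLpNorm_one_eq_lintegral_enorm]; rfl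

/-- Lipschitz functions are dense: clamping to `[a, b]` a smooth approximation of `u` does not
increase its distance from `u`. -/
lemma Admissible.exists_lipschitz {d : ℕ} {a b : ℝ} {u : Space d → ℝ} (hu : Admissible a b u)
    {ε : ENNReal} (hε : 0 < ε) : ∃ v : Space d → ℝ, Admissible a b v ∧
      (∃ K, LipschitzWith K v) ∧ wdist u v < ε := by
  have hab : a ≤ b := (hu.mem 0).1.trans (hu.mem 0).2
  have hd := Lp.dense_hasCompactSupport_contDiff (F := ℝ) (μ := weight d) (p := 1) (by simp)
  obtain ⟨g', hg', hlt⟩ := EMetric.mem_closure_iff.1 (hd ((hu.memLp 1).toLp u)) ε hε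
  obtain ⟨g, hgg', hgs, hgc⟩ := hg'
  obtain ⟨K, hK⟩ :=
    (hgc.of_le (by simp : (1 : WithTop ℕ∞) ≤ _)).lipschitzWith_of_hasCompactSupport hgs one_ne_zero
  have hclamp : LipschitzWith K fun x => max a (min b (g x)) := (hK.const_min b).const_max a
  refine ⟨fun x => max a (min b (g x)),
    ⟨hclamp.continuous.measurable, fun x => ⟨le_max_left _ _, max_le hab (min_le_left _ _)⟩⟩,
    ⟨K, hclamp⟩, lt_of_le_of_lt ?_ hlt⟩
  have h1 : edist ((hu.memLp 1).toLp u) g' = ∫⁻ x, ‖u x - g x‖ₑ ∂(weight d) := by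
    rw [Lp.edist_def, eLpNorm_one_eq_lintegral_enorm]
    refine lintegral_congr_ae ?_
    filter_upwards [hgg', (hu.memLp 1).coeFn_toLp] with x h1 h2
    rw [Pi.sub_apply, h1, h2]
  rw [h1]
  refine lintegral_mono fun x => ?_
  rw [Real.enorm_eq_ofReal_abs, Real.enorm_eq_ofReal_abs]
  refine ENNReal.ofReal_le_ofReal ?_
  obtain ⟨h1, h2⟩ := hu.mem x
  rcases max_cases a (min b (g x)) with h | h <;> rcases min_cases b (g x) with h' | h' <;>
    cases abs_cases (u x - g x) <;> rw [abs_le] <;> constructor <;> linarith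

lemma exists_dense_lipschitz (d : ℕ) {a b : ℝ} (hab : a ≤ b) :
    ∃ v : ℕ → Space d → ℝ, (∀ j, Admissible a b (v j) ∧ ∃ K, LipschitzWith K (v j)) ∧
      ∀ u, Admissible a b u → ∀ ε > 0, ∃ j, wdist u (v j) < ε := by
  have : Fact ((1 : ENNReal) ≠ ⊤) := ⟨ENNReal.one_ne_top⟩
  let S : Set (Lp ℝ 1 (weight d)) := {w | ∃ v : Space d → ℝ, ∃ hv : Admissible a b v,
    (∃ K, LipschitzWith K v) ∧ (hv.memLp 1).toLp v = w}
  have hcst : Admissible a b (fun _ : Space d => a) := ⟨measurable_const, fun _ => ⟨le_rfl, hab⟩⟩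
  have : Nonempty S := ⟨⟨_, _, hcst, ⟨0, LipschitzWith.const a⟩, rfl⟩⟩
  choose v hv hK hvw using fun j => (TopologicalSpace.denseSeq S j).2
  refine ⟨v, fun j => ⟨hv j, hK j⟩, fun u hu ε hε => ?_⟩
  have hε2 : 0 < ε / 2 := ENNReal.half_pos hε.ne'
  obtain ⟨w, hw, hwK, hwu⟩ := hu.exists_lipschitz hε2
  obtain ⟨_, ⟨j, rfl⟩, hj⟩ := EMetric.mem_closure_iff.1 (TopologicalSpace.denseRange_denseSeq S
    ⟨_, w, hw, hwK, rfl⟩) (ε / 2) hε2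
  refine ⟨j, (wdist_triangle hu.measurable hw.measurable).trans_lt ?_⟩
  rw [Subtype.edist_eq, ← hvw j, edist_toLp_eq_wdist] at hj
  calc _ < ε / 2 + ε / 2 := ENNReal.add_lt_add hwu hj
    _ = ε := ENNReal.add_halves ε

section Averages

variable {d : ℕ} {a b : ℝ}

/-- The normalized Lebesgue measure on the ball of radius `δ` about the origin. -/
noncomputable def ballMeasure (d : ℕ) (δ : ℝ) : Measure (Space d) :=
  ProbabilityTheory.cond volume (Metric.ball 0 δ)

lemma isProbabilityMeasure_ballMeasure {δ : ℝ} (hδ : 0 < δ) :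
    IsProbabilityMeasure (ballMeasure d δ) :=
  ProbabilityTheory.cond_isProbabilityMeasure_of_finite (Metric.measure_ball_pos _ _ hδ).ne'
    measure_ball_lt_top.ne

lemma ae_ballMeasure {δ : ℝ} : ∀ᵐ z ∂(ballMeasure d δ), ‖z‖ < δ := by
  have h := ProbabilityTheory.ae_cond_mem (μ := (volume : Measure (Space d)))
    (s := Metric.ball 0 δ) measurableSet_ball
  exact h.mono fun z hz => by simpa using hz

/-- Ball averages are integrals against fixed integrable functions. -/
lemma integral_ballMeasure_eq {δ : ℝ} (v : Space d → ℝ) (x : Space d) :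
    ∫ z, v (x + z) ∂(ballMeasure d δ) = ∫ y, v y *
      (Metric.ball x δ).indicator (fun _ => (volume (Metric.ball (0 : Space d) δ))⁻¹.toReal) y := by
  rw [ballMeasure, ProbabilityTheory.cond, integral_smul_measure,
    ← integral_indicator measurableSet_ball, smul_eq_mul, ← integral_const_mul,
    ← integral_sub_right_eq_self _ x]
  refine integral_congr_ae (ae_of_all _ fun y => ?_)
  by_cases hy : ‖y - x‖ < δ
  · simp only [indicator, mem_ball_iff_norm, hy, sub_zero, if_true, add_sub_cancel, mul_comm]
  · simp only [indicator, mem_ball_iff_norm, hy, sub_zero, if_false, mul_zero]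

lemma Admissible.integrable {v : Space d → ℝ} (hv : Admissible a b v) (μ : Measure (Space d))
    [IsFiniteMeasure μ] : Integrable v μ :=
  Integrable.of_bound hv.measurable.aestronglyMeasurable (|a| + |b|) (ae_of_all _ fun x =>
    abs_le_of_monotone monotone_id (hv.mem x))

lemma wdist_ballMeasure_le {δ : ℝ} (hδ : 0 < δ) {v : Space d → ℝ} (hv : Admissible a b v)
    {ε : ENNReal} (h : ∀ z, ‖z‖ < δ → wdist (fun x => v (x + z)) v ≤ ε) :
    wdist (fun x => ∫ z, v (x + z) ∂(ballMeasure d δ)) v ≤ ε := by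
  have := isProbabilityMeasure_ballMeasure (d := d) hδ
  have hm : Measurable fun p : Space d × Space d => ‖v (p.1 + p.2) - v p.1‖ₑ :=
    ((hv.measurable.comp (measurable_fst.add measurable_snd)).sub
      (hv.measurable.comp measurable_fst)).enorm
  calc wdist (fun x => ∫ z, v (x + z) ∂(ballMeasure d δ)) v
      ≤ ∫⁻ x, (∫⁻ z, ‖v (x + z) - v x‖ₑ ∂(ballMeasure d δ)) ∂(weight d) := by
        refine lintegral_mono fun x => ?_
        have h1 : (∫ z, v (x + z) ∂(ballMeasure d δ)) - v x =
            ∫ z, (v (x + z) - v x) ∂(ballMeasure d δ) := by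
          have hi : Integrable (fun z => v (x + z)) (ballMeasure d δ) := by
            simpa only [add_comm x] using (hv.translate x).integrable (ballMeasure d δ)
          rw [integral_sub hi (integrable_const _)]
          simp
        rw [h1]
        exact enorm_integral_le_lintegral_enorm _
    _ = ∫⁻ z, (∫⁻ x, ‖v (x + z) - v x‖ₑ ∂(weight d)) ∂(ballMeasure d δ) :=
        lintegral_lintegral_swap hm.aemeasurable
    _ ≤ ∫⁻ _, ε ∂(ballMeasure d δ) := lintegral_mono_ae (ae_ballMeasure.mono fun z hz => h z hz)
    _ = ε := by simp

lemma measurable_ballAverage {δ : ℝ} (hδ : 0 < δ) {v : Space d → ℝ} (hv : Measurable v) :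
    Measurable fun x => ∫ z, v (x + z) ∂(ballMeasure d δ) := by
  have := isProbabilityMeasure_ballMeasure (d := d) hδ
  have : Measurable fun p : Space d × Space d => v (p.1 + p.2) :=
    hv.comp (measurable_fst.add measurable_snd)
  exact (this.stronglyMeasurable.integral_prod_right (ν := ballMeasure d δ)).measurable

lemma ballAverage_mem {δ : ℝ} (hδ : 0 < δ) {v : Space d → ℝ} (hv : Admissible a b v)
    (x : Space d) : ∫ z, v (x + z) ∂(ballMeasure d δ) ∈ Icc a b := by
  have := isProbabilityMeasure_ballMeasure (d := d) hδ
  have hi : Integrable (fun z => v (x + z)) (ballMeasure d δ) := by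
    simpa only [add_comm x] using (hv.translate x).integrable (ballMeasure d δ)
  have h1 := integral_mono (integrable_const a) hi fun z => (hv.mem (x + z)).1
  have h2 := integral_mono hi (integrable_const b) fun z => (hv.mem (x + z)).2
  simp at h1 h2
  exact ⟨h1, h2⟩

/-- A sequence of uniformly bounded functions which converges weakly and has a uniform modulus of
continuity under translations is a Cauchy sequence in the weighted `L¹` distance: its ball averages
converge pointwise, and they are uniformly close to it. -/
lemma tendsto_wdist_of_weak {v : ℕ → Space d → ℝ} (hv : ∀ k, Admissible a b (v k))
    (htr : ∀ ε > 0, ∃ δ > 0, ∀ k, ∀ z, ‖z‖ < δ → wdist (fun x => v k (x + z)) (v k) ≤ ε)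
    (hw : ∀ G : Space d → ℝ, Integrable G → CauchySeq fun k => ∫ y, v k y * G y) :
    Tendsto (fun p : ℕ × ℕ => wdist (v p.1) (v p.2)) atTop (𝓝 0) := by
  rw [ENNReal.tendsto_nhds_zero]
  intro ε hε
  have hε3 : 0 < ε / 3 := ENNReal.div_pos hε.ne' (by simp)
  obtain ⟨δ, hδ, htr⟩ := htr (ε / 3) hε3
  set m : ℕ → Space d → ℝ := fun k x => ∫ z, v k (x + z) ∂(ballMeasure d δ) with hm
  have hmm : ∀ k, Measurable (m k) := fun k => measurable_ballAverage hδ (hv k).measurable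
  have hmv : ∀ k, wdist (m k) (v k) ≤ ε / 3 := fun k =>
    wdist_ballMeasure_le hδ (hv k) (htr k)
  have hc : ∀ x, CauchySeq fun k => m k x := by
    intro x
    simp only [hm, integral_ballMeasure_eq]
    refine hw _ ((integrable_indicator_iff measurableSet_ball).2 ?_)
    exact integrableOn_const measure_ball_lt_top.ne
  have hlim : Tendsto (fun p : ℕ × ℕ => wdist (m p.1) (m p.2)) atTop (𝓝 0) := by
    have : Tendsto (fun p : ℕ × ℕ => ∫⁻ x, ‖m p.1 x - m p.2 x‖ₑ ∂(weight d)) atTop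
        (𝓝 (∫⁻ _, 0 ∂(weight d))) := by
      refine tendsto_lintegral_filter_of_dominated_convergence (fun _ => ENNReal.ofReal (b - a))
        (Eventually.of_forall fun p => ((hmm _).sub (hmm _)).enorm)
        (Eventually.of_forall fun p => ae_of_all _ fun x => ?_) ?_ (ae_of_all _ fun x => ?_)
      · rw [Real.enorm_eq_ofReal_abs]
        exact ENNReal.ofReal_le_ofReal
          (abs_sub_le_of_mem_Icc (ballAverage_mem hδ (hv _) x) (ballAverage_mem hδ (hv _) x))
      · rw [lintegral_const]
        exact ENNReal.mul_ne_top ENNReal.ofReal_ne_top (measure_ne_top _ _)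
      · have h1 := cauchySeq_iff_tendsto_dist_atTop_0.1 (hc x)
        have h2 := (ENNReal.continuous_ofReal.tendsto 0).comp h1
        rw [ENNReal.ofReal_zero] at h2
        refine h2.congr fun p => ?_
        simp [Real.dist_eq, Real.enorm_eq_ofReal_abs]
    rw [lintegral_const, zero_mul] at this
    exact this
  filter_upwards [ENNReal.tendsto_nhds_zero.1 hlim (ε / 3) hε3] with p hp
  calc wdist (v p.1) (v p.2)
      ≤ wdist (v p.1) (m p.1) + (wdist (m p.1) (m p.2) + wdist (m p.2) (v p.2)) :=
        (wdist_triangle (hv _).measurable (hmm _)).trans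
          (add_le_add le_rfl (wdist_triangle (hmm _) (hmm _)))
    _ ≤ ε / 3 + (ε / 3 + ε / 3) := by
        rw [wdist_comm]
        exact add_le_add (hmv _) (add_le_add hp (hmv _))
    _ = ε := by rw [← add_assoc, ENNReal.add_thirds]

end Averages

lemma exists_subseq_cauchySeq {ι : Type*} [Countable ι] (r : ℕ → ι → ℝ) (C : ι → ℝ)
    (hr : ∀ k i, |r k i| ≤ C i) :
    ∃ φ : ℕ → ℕ, StrictMono φ ∧ ∀ i, CauchySeq fun k => r (φ k) i := by
  have hK : IsCompact (Set.pi univ fun i => Icc (-C i) (C i)) :=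
    isCompact_univ_pi fun i => isCompact_Icc
  obtain ⟨l, -, φ, hφ, hl⟩ := hK.isSeqCompact (x := r) fun k i _ => abs_le.1 (hr k i)
  exact ⟨φ, hφ, fun i => ((tendsto_pi_nhds.1 hl) i).cauchySeq⟩

/-- Weak convergence of a uniformly bounded sequence need only be tested on a dense family. -/
lemma cauchySeq_integral_mul_of_dense {d : ℕ} {a b : ℝ} {g : ℕ → Space d → ℝ}
    (hg : ∀ j, Integrable (g j))
    (hgd : ∀ G : Space d → ℝ, Integrable G → ∀ ε > 0, ∃ j, ∫ x, |G x - g j x| ≤ ε)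
    {v : ℕ → Space d → ℝ} (hv : ∀ k, Admissible a b (v k))
    (hc : ∀ j, CauchySeq fun k => ∫ y, v k y * g j y) {G : Space d → ℝ} (hG : Integrable G) :
    CauchySeq fun k => ∫ y, v k y * G y := by
  have hb : ∀ k x, ‖v k x‖ ≤ |a| + |b| := fun k x => abs_le_of_monotone monotone_id ((hv k).mem x)
  have hi : ∀ k (F : Space d → ℝ), Integrable F → Integrable fun y => v k y * F y := fun k F hF =>
    hF.bdd_mul (hv k).measurable.aestronglyMeasurable (ae_of_all _ (hb k))
  rw [Metric.cauchySeq_iff]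
  intro ε hε
  set B := |a| + |b| + 1 with hB
  have hB0 : 0 < B := by positivity
  obtain ⟨j, hj⟩ := hgd G hG (ε / (3 * B)) (by positivity)
  have hclose : ∀ k, |(∫ y, v k y * G y) - ∫ y, v k y * g j y| ≤ ε / 3 := by
    intro k
    rw [← integral_sub (hi k G hG) (hi k _ (hg j))]
    refine abs_integral_le_integral_abs.trans ?_
    calc ∫ y, |v k y * G y - v k y * g j y| ≤ ∫ y, B * |G y - g j y| := by
          refine integral_mono ((hi k G hG).sub (hi k _ (hg j))).abs
            ((hG.sub (hg j)).abs.const_mul B) fun y => ?_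
          simp only [← mul_sub, abs_mul]
          gcongr
          have := hb k y
          rw [Real.norm_eq_abs] at this
          linarith
      _ ≤ B * (ε / (3 * B)) := by rw [integral_const_mul]; gcongr
      _ = ε / 3 := by field_simp
  obtain ⟨N, hN⟩ := Metric.cauchySeq_iff.1 (hc j) (ε / 3) (by positivity)
  refine ⟨N, fun m hm n hn => ?_⟩
  have h1 := hN m hm n hn
  have h2 := hclose m
  have h3 := hclose n
  rw [Real.dist_eq] at h1 ⊢
  rw [abs_le] at h2 h3
  rw [abs_lt] at h1 ⊢
  constructor <;> linarith

/-- There is one sequence of time steps along which the approximate solutions with arbitrary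
bounded measurable initial data converge, at every time. Since transport-collapse contracts the
distance of solutions, it suffices to have convergence for countably many data. -/
theorem exists_steps_tendsto {d : ℕ} {c : ℝ → Space d} {a b L : ℝ} (hab : a ≤ b)
    (hc : Measurable c) (hL0 : 0 ≤ L) (hL : ∀ ξ ∈ Icc a b, ‖c ξ‖ ≤ L) :
    ∃ h : ℕ → ℝ, (∀ k, 0 < h k) ∧ (∀ k, h k ≤ 1) ∧ Tendsto h atTop (𝓝 0) ∧
      ∀ u, Admissible a b u → ∀ t, 0 ≤ t → Tendsto (fun p : ℕ × ℕ =>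
        wdist (approx c a b (h p.1) u t) (approx c a b (h p.2) u t)) atTop (𝓝 0) := by
  obtain ⟨v, hv, hvd⟩ := exists_dense_lipschitz d hab
  obtain ⟨g, hg, hgd⟩ := exists_dense_integrable d
  let h₀ : ℕ → ℝ := fun k => 1 / ((k : ℝ) + 1)
  have h₀pos : ∀ k, 0 < h₀ k := fun k => by positivity
  obtain ⟨φ, hφ, hcau⟩ := exists_subseq_cauchySeq
    (fun k (i : ℕ × ℚ × ℕ) => ∫ y, approx c a b (h₀ k) (v i.1) (i.2.1 : ℝ) y * g i.2.2 y)
    (fun i => ∫ y, (|a| + |b|) * |g i.2.2 y|) (fun k i => by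
      refine abs_integral_le_integral_abs.trans (integral_mono_of_nonneg
        (ae_of_all _ fun y => abs_nonneg _) ((hg _).abs.const_mul _) (ae_of_all _ fun y => ?_))
      simp only [abs_mul]
      gcongr
      exact abs_le_of_monotone monotone_id (((hv i.1).1.approx hab hc i.2.1).mem y))
  set h : ℕ → ℝ := fun k => h₀ (φ k) with hh
  have hpos : ∀ k, 0 < h k := fun k => h₀pos _
  have hto : Tendsto h atTop (𝓝 0) :=
    tendsto_one_div_add_atTop_nhds_zero_nat.comp hφ.tendsto_atTop
  refine ⟨h, hpos, fun k => ?_, hto, ?_⟩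
  · simp only [hh, h₀]
    rw [div_le_one (by positivity)]
    linarith [Nat.cast_nonneg (α := ℝ) (φ k)]
  have hadm : ∀ {u}, Admissible a b u → ∀ k t, Admissible a b (approx c a b (h k) u t) :=
    fun hu k t => hu.approx hab hc t
  have hcau' : ∀ j (s : ℚ) i, CauchySeq fun k =>
      ∫ y, approx c a b (h k) (v j) s y * g i y := fun j s i => hcau (j, s, i)
  -- Convergence for the dense data at rational times.
  have hrat : ∀ j (s : ℚ), (0 : ℝ) ≤ s → Tendsto (fun p : ℕ × ℕ =>
      wdist (approx c a b (h p.1) (v j) s) (approx c a b (h p.2) (v j) s)) atTop (𝓝 0) := by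
    intro j s hs
    have hweak : ∀ G : Space d → ℝ, Integrable G →
        CauchySeq fun k => ∫ y, approx c a b (h k) (v j) s y * G y := fun G hG =>
      cauchySeq_integral_mul_of_dense (v := fun k => approx c a b (h k) (v j) s) hg hgd
        (fun k => hadm (hv j).1 k s) (hcau' j s) hG
    refine tendsto_wdist_of_weak (v := fun k => approx c a b (h k) (v j) s)
      (fun k => hadm (hv j).1 k s) (fun ε hε => ?_) hweak
    obtain ⟨K, hK⟩ := (hv j).2
    have hcont : Tendsto (fun δ : ℝ => ENNReal.ofReal (Real.exp ((d + 1) * L * s)) *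
        (ENNReal.ofReal (K * δ) * weight d univ)) (𝓝 0) (𝓝 0) := by
      have h1 : Tendsto (fun δ : ℝ => ENNReal.ofReal (K * δ)) (𝓝 0) (𝓝 0) := by
        have : Continuous fun δ : ℝ => ENNReal.ofReal (K * δ) :=
          ENNReal.continuous_ofReal.comp (by fun_prop)
        simpa using this.tendsto 0
      have h2 := ENNReal.Tendsto.mul_const (b := weight d univ) h1 (Or.inr (measure_ne_top _ _))
      have h3 := ENNReal.Tendsto.const_mul (a := ENNReal.ofReal (Real.exp ((d + 1) * L * s))) h2
        (Or.inr ENNReal.ofReal_ne_top)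
      simpa using h3
    obtain ⟨δ, hδ, hδε⟩ := Metric.eventually_nhds_iff.1 (ENNReal.tendsto_nhds_zero.1 hcont ε hε)
    refine ⟨δ / 2, by positivity, fun k z hz => ?_⟩
    refine (wdist_approx_translate_le hab hc hL0 hL (hpos k) (hv j).1 hs z).trans
      (le_trans ?_ (hδε (y := δ / 2) (by
        rw [Real.dist_eq, sub_zero, abs_of_pos (by positivity)]; linarith)))
    gcongr
    refine wdist_le_of_forall fun x => ?_
    have := hK.dist_le_mul (x + z) x
    rw [Real.dist_eq, dist_eq_norm, add_sub_cancel_left] at this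
    exact this.trans (by gcongr)
  -- Convergence for the dense data at all times.
  have hall : ∀ j (t : ℝ), 0 ≤ t → Tendsto (fun p : ℕ × ℕ =>
      wdist (approx c a b (h p.1) (v j) t) (approx c a b (h p.2) (v j) t)) atTop (𝓝 0) := by
    intro j t ht
    obtain ⟨K, hK⟩ := (hv j).2
    rw [ENNReal.tendsto_nhds_zero]
    intro ε hε
    have hε3 : 0 < ε / 3 := ENNReal.div_pos hε.ne' (by simp)
    have hcont : Tendsto (fun δ : ℝ => ENNReal.ofReal (Real.exp ((d + 1) * L * (t + δ)) *
        (K * L * δ)) * weight d univ) (𝓝 0) (𝓝 0) := by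
      have h1 : Tendsto (fun δ : ℝ => ENNReal.ofReal (Real.exp ((d + 1) * L * (t + δ)) *
          (K * L * δ))) (𝓝 0) (𝓝 0) := by
        have : Continuous fun δ : ℝ => ENNReal.ofReal (Real.exp ((d + 1) * L * (t + δ)) *
          (K * L * δ)) :=
          ENNReal.continuous_ofReal.comp (by fun_prop)
        simpa using this.tendsto 0
      have h2 := ENNReal.Tendsto.mul_const (b := weight d univ) h1 (Or.inr (measure_ne_top _ _))
      simpa using h2
    obtain ⟨δ, hδ, hδε⟩ :=
      Metric.eventually_nhds_iff.1 (ENNReal.tendsto_nhds_zero.1 hcont (ε / 3) hε3)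
    obtain ⟨s, hts, hst⟩ := exists_rat_btwn (show t < t + δ / 4 by linarith)
    have hsmall : ∀ᶠ k in atTop, h k < δ / 4 := hto.eventually_lt_const (by positivity)
    have htime : ∀ k, h k < δ / 4 →
        wdist (approx c a b (h k) (v j) t) (approx c a b (h k) (v j) s) ≤ ε / 3 := by
      intro k hk
      refine (wdist_approx_time_le hab hc hL0 hL (hpos k) (hv j).1 hK ht hts.le).trans
        (le_trans ?_ (hδε (y := δ / 2) (by
          rw [Real.dist_eq, sub_zero, abs_of_pos (by positivity)]; linarith)))
      have hk0 := hpos k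
      have : 0 ≤ (s : ℝ) - t + h k := by linarith
      gcongr
      · linarith
      · linarith
    have hsmall2 : ∀ᶠ p : ℕ × ℕ in atTop, h p.1 < δ / 4 ∧ h p.2 < δ / 4 := by
      rw [← prod_atTop_atTop_eq]; exact hsmall.prod_mk hsmall
    filter_upwards [hsmall2, ENNReal.tendsto_nhds_zero.1 (hrat j s (ht.trans hts.le)) (ε / 3) hε3]
      with p hp1 hp2
    have hm := fun k r => (hadm (hv j).1 k r).measurable
    calc _ ≤ _ := (wdist_triangle (hm p.1 t) (hm p.1 s)).trans
          (add_le_add le_rfl (wdist_triangle (hm p.1 s) (hm p.2 s)))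
      _ ≤ ε / 3 + (ε / 3 + ε / 3) := by
        refine add_le_add (htime _ hp1.1) (add_le_add hp2 ?_)
        rw [wdist_comm]; exact htime _ hp1.2
      _ = ε := by rw [← add_assoc, ENNReal.add_thirds]
  -- Convergence for all data, by contraction.
  intro u hu t ht
  rw [ENNReal.tendsto_nhds_zero]
  intro ε hε
  have hε3 : 0 < ε / 3 := ENNReal.div_pos hε.ne' (by simp)
  set E := ENNReal.ofReal (Real.exp ((d + 1) * L * t)) with hE
  have hE0 : E ≠ 0 := by
    rw [hE, Ne, ENNReal.ofReal_eq_zero, not_le]; exact Real.exp_pos _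
  have hEt : E ≠ ⊤ := ENNReal.ofReal_ne_top
  obtain ⟨j, hj⟩ := hvd u hu (ε / 3 / E) (ENNReal.div_pos hε3.ne' hEt)
  have hcl : ∀ k, wdist (approx c a b (h k) u t) (approx c a b (h k) (v j) t) ≤ ε / 3 := by
    intro k
    refine (wdist_approx_le hab hc hL0 hL (hpos k) hu (hv j).1 ht).trans ?_
    calc E * wdist u (v j) ≤ E * (ε / 3 / E) := by gcongr
      _ = ε / 3 := ENNReal.mul_div_cancel hE0 hEt
  filter_upwards [ENNReal.tendsto_nhds_zero.1 (hall j t ht) (ε / 3) hε3] with p hp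
  have hm := fun k => (hadm hu k t).measurable
  have hm' := fun k => (hadm (hv j).1 k t).measurable
  calc _ ≤ _ := (wdist_triangle (hm p.1) (hm' p.1)).trans
        (add_le_add le_rfl (wdist_triangle (hm' p.1) (hm' p.2)))
    _ ≤ ε / 3 + (ε / 3 + ε / 3) := by
      refine add_le_add (hcl _) (add_le_add hp ?_)
      rw [wdist_comm]; exact hcl _
    _ = ε := by rw [← add_assoc, ENNReal.add_thirds]

/-! ### The discrete entropy inequality -/

lemma integrable_of_bdd_of_support {α : Type*} [MeasurableSpace α] {μ : Measure α} {F : α → ℝ}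
    (hF : Measurable F) {S : Set α} (hμ : μ S ≠ ⊤) {C : ℝ}
    (hC : ∀ z, |F z| ≤ C) (h0 : ∀ z, z ∉ S → F z = 0) : Integrable F μ := by
  have h1 : IntegrableOn F S μ :=
    Measure.integrableOn_of_bounded hμ hF.aestronglyMeasurable (ae_of_all _ hC)
  exact (integrableOn_iff_integrable_of_support_subset (fun z hz => by
    by_contra h; exact hz (h0 z h))).1 h1

/-- Quantitative compactness of the support of a test function. -/
lemma IsTestFunction.exists_bounds {d : ℕ} {φ : Space d × ℝ → ℝ} (hφ : IsTestFunction φ) :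
    ∃ R C : ℝ, 0 ≤ R ∧ 0 ≤ C ∧ (∀ z, |φ z| ≤ C) ∧ (∀ z, ‖fderiv ℝ φ z‖ ≤ C) ∧
      (∀ z, R < ‖z‖ → φ z = 0) ∧ ∀ z, R < ‖z‖ → fderiv ℝ φ z = 0 := by
  obtain ⟨C₁, h1⟩ := hφ.compactSupport.exists_bound_of_continuous hφ.contDiff.continuous
  obtain ⟨C₂, h2⟩ := (hφ.compactSupport.fderiv ℝ).exists_bound_of_continuous
    (hφ.contDiff.continuous_fderiv one_ne_zero)
  obtain ⟨R, hR⟩ := hφ.compactSupport.isCompact.isBounded.subset_closedBall 0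
  have hsupp : ∀ z, max R 0 < ‖z‖ → z ∉ tsupport φ := fun z hz h => by
    have := hR h
    rw [mem_closedBall_zero_iff] at this
    exact absurd (lt_of_le_of_lt (le_max_left _ _) hz) (not_lt.2 this)
  refine ⟨max R 0, max (max C₁ C₂) 0, le_max_right _ _, le_max_right _ _,
    fun z => (h1 z).trans ((le_max_left _ _).trans (le_max_left _ _)),
    fun z => (h2 z).trans ((le_max_right _ _).trans (le_max_left _ _)),
    fun z hz => image_eq_zero_of_notMem_tsupport (hsupp z hz), fun z hz => ?_⟩
  by_contra h
  exact hsupp z hz (support_fderiv_subset ℝ h)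

section

variable {d : ℕ} {c : ℝ → Space d} {a b h L B : ℝ} {p : ℝ → ℝ} {φ : Space d × ℝ → ℝ}

/-- The kinetic entropy `∫ η'(ξ) 1_{ξ < v} dξ` of the value `v`, equal to `η(v) - η(a)`. -/
noncomputable def kinEntropy (p : ℝ → ℝ) (a b v : ℝ) : ℝ := ∫ ξ in Ioc a b, p ξ * step ξ v

/-- The integrand of the kinetic weak form: the derivative of the test function `φ` along the
characteristic with speed `c ξ` through `(y, t)`, at the point displaced by `s • c ξ`, integrated
against the kinetic function of the value `v`. -/
noncomputable def kinDeriv (c : ℝ → Space d) (p : ℝ → ℝ) (a b : ℝ) (φ : Space d × ℝ → ℝ)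
    (v s : ℝ) (y : Space d) (t : ℝ) : ℝ :=
  ∫ ξ in Ioc a b, p ξ * step ξ v * fderiv ℝ φ (y + s • c ξ, t) (c ξ, 1)

lemma measurable_kinEntropy (hp : Measurable p) : Measurable (kinEntropy p a b) := by
  have : Measurable fun z : ℝ × ℝ => p z.2 * step z.2 z.1 :=
    (hp.comp measurable_snd).mul (measurable_step_comp measurable_snd measurable_fst)
  exact (this.stronglyMeasurable.integral_prod_right (ν := volume.restrict (Ioc a b))).measurable

lemma abs_mul_step_le (hB : ∀ ξ, |p ξ| ≤ B) (ξ v : ℝ) : |p ξ * step ξ v| ≤ B := by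
  rw [abs_mul]
  exact (mul_le_of_le_one_right (abs_nonneg _) (abs_step_le_one _ _)).trans (hB ξ)

lemma measurable_fderiv_comp (hφ : IsTestFunction φ) {α : Type*} [MeasurableSpace α]
    {g : α → Space d × ℝ} {w : α → Space d × ℝ} (hg : Measurable g) (hw : Measurable w) :
    Measurable fun x => fderiv ℝ φ (g x) (w x) :=
  (hφ.contDiff.continuous_fderiv_apply one_ne_zero).measurable.comp (hg.prodMk hw)

lemma measurable_kinDeriv (hc : Measurable c) (hp : Measurable p) (hφ : IsTestFunction φ)
    {α : Type*} [MeasurableSpace α] {v s t : α → ℝ} {y : α → Space d} (hv : Measurable v)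
    (hs : Measurable s) (hy : Measurable y) (ht : Measurable t) :
    Measurable fun x => kinDeriv c p a b φ (v x) (s x) (y x) (t x) := by
  have : Measurable fun z : α × ℝ => p z.2 * step z.2 (v z.1) *
      fderiv ℝ φ (y z.1 + s z.1 • c z.2, t z.1) (c z.2, 1) := by
    refine ((hp.comp measurable_snd).mul (measurable_step_comp measurable_snd
      (hv.comp measurable_fst))).mul (measurable_fderiv_comp hφ ?_ ?_)
    · exact ((hy.comp measurable_fst).add ((hs.comp measurable_fst).smul
        (hc.comp measurable_snd))).prodMk (ht.comp measurable_fst)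
    · exact (hc.comp measurable_snd).prodMk measurable_const
  exact (this.stronglyMeasurable.integral_prod_right (ν := volume.restrict (Ioc a b))).measurable

lemma norm_speed_le (hL : ∀ ξ, ‖c ξ‖ ≤ L) (ξ : ℝ) : ‖((c ξ, 1) : Space d × ℝ)‖ ≤ L + 1 := by
  have h0 := norm_nonneg (c ξ)
  have := hL ξ
  rw [Prod.norm_def, norm_one]
  exact max_le (by linarith) (by linarith)

lemma abs_kinDeriv_integrand_le {C : ℝ} (hL : ∀ ξ, ‖c ξ‖ ≤ L) (hB : ∀ ξ, |p ξ| ≤ B)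
    (hC : ∀ z, ‖fderiv ℝ φ z‖ ≤ C) (z : Space d × ℝ) (ξ v : ℝ) :
    |p ξ * step ξ v * fderiv ℝ φ z (c ξ, 1)| ≤ B * (C * (L + 1)) := by
  rw [abs_mul]
  have hB0 : 0 ≤ B := (abs_nonneg _).trans (hB 0)
  have hC0 : 0 ≤ C := (norm_nonneg _).trans (hC z)
  refine mul_le_mul (abs_mul_step_le hB ξ v) ?_ (abs_nonneg _) hB0
  refine ((fderiv ℝ φ z).le_opNorm _).trans ?_
  exact mul_le_mul (hC z) (norm_speed_le hL ξ) (norm_nonneg _) hC0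

lemma abs_kinDeriv_le (hab : a ≤ b) {C : ℝ} (hL : ∀ ξ, ‖c ξ‖ ≤ L) (hB : ∀ ξ, |p ξ| ≤ B)
    (hC : ∀ z, ‖fderiv ℝ φ z‖ ≤ C) (v s : ℝ) (y : Space d) (t : ℝ) :
    |kinDeriv c p a b φ v s y t| ≤ B * (C * (L + 1)) * (b - a) := by
  have := norm_setIntegral_le_of_norm_le_const (μ := volume) (s := Ioc a b)
    (f := fun ξ => p ξ * step ξ v * fderiv ℝ φ (y + s • c ξ, t) (c ξ, 1))
    measure_Ioc_lt_top fun ξ _ => abs_kinDeriv_integrand_le hL hB hC _ ξ v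
  simpa [kinDeriv, Measure.real, Real.volume_Ioc, ENNReal.toReal_ofReal (sub_nonneg.2 hab)]
    using this

lemma lt_norm_of_displaced (hL : ∀ ξ, ‖c ξ‖ ≤ L) {R s t : ℝ} {y : Space d} (hs : |s| ≤ 1)
    (h : R + L < ‖y‖ ∨ R < |t|) (ξ : ℝ) : R < ‖((y + s • c ξ, t) : Space d × ℝ)‖ := by
  rw [Prod.norm_def, Real.norm_eq_abs, lt_max_iff]
  refine h.imp_left fun h => ?_
  have h1 : ‖y‖ ≤ ‖y + s • c ξ‖ + ‖s • c ξ‖ := by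
    simpa using norm_sub_le (y + s • c ξ) (s • c ξ)
  have h2 : ‖s • c ξ‖ ≤ L := by
    rw [norm_smul, Real.norm_eq_abs]
    exact (mul_le_of_le_one_left (norm_nonneg _) hs).trans (hL ξ)
  linarith

lemma kinDeriv_eq_zero (hL : ∀ ξ, ‖c ξ‖ ≤ L) {R s t : ℝ} {y : Space d}
    (hR : ∀ z, R < ‖z‖ → fderiv ℝ φ z = 0) (hs : |s| ≤ 1) (h : R + L < ‖y‖ ∨ R < |t|) (v : ℝ) :
    kinDeriv c p a b φ v s y t = 0 := by
  unfold kinDeriv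
  simp [hR _ (lt_norm_of_displaced hL hs h _)]

/-- The discrete entropy inequality for one time step. -/
lemma entropy_step_le (hab : a ≤ b) (hc : Measurable c) (hL : ∀ ξ, ‖c ξ‖ ≤ L) (hp : Monotone p)
    (hB : ∀ ξ, |p ξ| ≤ B) (hφ : IsTestFunction φ) (hh0 : 0 < h) (hh1 : h ≤ 1) {t₀ : ℝ}
    (hpos : ∀ x, 0 ≤ φ (x, t₀ + h)) {u : Space d → ℝ} (hu : Admissible a b u) :
    (∫ x, φ (x, t₀ + h) * kinEntropy p a b (collapse c a b h u x))
      - ∫ x, φ (x, t₀) * kinEntropy p a b (u x) ≤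
    ∫ s in (0 : ℝ)..h, ∫ y, kinDeriv c p a b φ (u y) s y (t₀ + s) := by
  obtain ⟨R, C, hR0, hC0, hC, hC', hR, hR'⟩ := hφ.exists_bounds
  have hpm := hp.measurable
  have hB0 : 0 ≤ B := (abs_nonneg _).trans (hB 0)
  have hL0 : 0 ≤ L := (norm_nonneg _).trans (hL 0)
  set ν : Measure ℝ := volume.restrict (Ioc a b) with hν
  set κ : Measure (Space d × ℝ) := volume.prod ν with hκ
  set K : Set (Space d × ℝ) := Metric.closedBall 0 (R + L) ×ˢ univ with hK
  have hKm : MeasurableSet K := measurableSet_closedBall.prod MeasurableSet.univ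
  have hKμ : κ K ≠ ⊤ := by
    rw [hκ, hK, Measure.prod_prod]
    exact ENNReal.mul_ne_top measure_closedBall_lt_top.ne (measure_ne_top _ _)
  have hKc : ∀ z : Space d × ℝ, z ∉ K → R + L < ‖z.1‖ := fun z hz => by
    by_contra hcon
    exact hz ⟨mem_closedBall_zero_iff.2 (not_lt.1 hcon), trivial⟩
  have hφm := hφ.contDiff.continuous.measurable
  have hstep : Measurable fun z : Space d × ℝ => p z.2 * step z.2 (u z.1) :=
    (hpm.comp measurable_snd).mul (measurable_step_comp measurable_snd
      (hu.measurable.comp measurable_fst))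
  have hmulB : ∀ (z w : Space d × ℝ) v, |φ z * (p w.2 * step w.2 v)| ≤ C * B := fun z w v => by
    rw [abs_mul]
    exact mul_le_mul (hC z) (abs_mul_step_le hB _ _) (abs_nonneg _) hC0
  -- The three integrands on `space × velocity`.
  have hi0 : Integrable (fun z : Space d × ℝ => φ (z.1, t₀) * (p z.2 * step z.2 (u z.1))) κ := by
    refine integrable_of_bdd_of_support ((hφm.comp (measurable_fst.prodMk measurable_const)).mul
      hstep) hKμ (fun z => hmulB _ _ _) fun z hz => ?_
    have := lt_norm_of_displaced (s := 0) (t := t₀) hL (by simp) (Or.inl (hKc z hz)) 0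
    rw [zero_smul, add_zero] at this
    rw [hR _ this, zero_mul]
  have hi1 : Integrable (fun z : Space d × ℝ =>
      φ (z.1, t₀ + h) * (p z.2 * step z.2 (u (z.1 - h • c z.2)))) κ := by
    refine integrable_of_bdd_of_support ((hφm.comp (measurable_fst.prodMk measurable_const)).mul
      ((hpm.comp measurable_snd).mul (measurable_step_comp measurable_snd (hu.measurable.comp
      (measurable_fst.sub ((hc.comp measurable_snd).const_smul h))))))
      hKμ (fun z => hmulB _ _ _) fun z hz => ?_
    have := lt_norm_of_displaced (s := 0) (t := t₀ + h) hL (by simp) (Or.inl (hKc z hz)) 0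
    rw [zero_smul, add_zero] at this
    rw [hR _ this, zero_mul]
  have hi2 : Integrable (fun z : Space d × ℝ =>
      φ (z.1 + h • c z.2, t₀ + h) * (p z.2 * step z.2 (u z.1))) κ := by
    refine integrable_of_bdd_of_support ((hφm.comp ((measurable_fst.add
      ((hc.comp measurable_snd).const_smul h)).prodMk measurable_const)).mul
      hstep) hKμ (fun z => hmulB _ _ _) fun z hz => ?_
    rw [hR _ (lt_norm_of_displaced (t := t₀ + h) hL (by rwa [abs_of_pos hh0])
      (Or.inl (hKc z hz)) z.2), zero_mul]
  have hE0 : ∫ x, φ (x, t₀) * kinEntropy p a b (u x) =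
      ∫ z, φ (z.1, t₀) * (p z.2 * step z.2 (u z.1)) ∂κ := by
    rw [integral_prod _ hi0]
    simp only [kinEntropy, integral_const_mul, hν]
  have hE1 : ∫ x, φ (x, t₀ + h) * kinEntropy p a b (collapse c a b h u x) ≤
      ∫ z, φ (z.1, t₀ + h) * (p z.2 * step z.2 (u (z.1 - h • c z.2))) ∂κ := by
    rw [integral_prod _ hi1]
    refine integral_mono ?_ hi1.integral_prod_left fun x => ?_
    · refine integrable_of_bdd_of_support (S := Metric.closedBall 0 R) (C := C * (B * (b - a)))
        ((hφm.comp (measurable_id.prodMk measurable_const)).mul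
          ((measurable_kinEntropy hpm).comp (measurable_collapse hc hu.measurable)))
        measure_closedBall_lt_top.ne (fun x => ?_) fun x hx => ?_
      · rw [abs_mul]
        refine mul_le_mul (hC _) ?_ (abs_nonneg _) hC0
        have := norm_setIntegral_le_of_norm_le_const (μ := volume) (s := Ioc a b)
          (f := fun ξ => p ξ * step ξ (collapse c a b h u x))
          measure_Ioc_lt_top fun ξ _ => abs_mul_step_le hB ξ _
        simpa [kinEntropy, Measure.real, Real.volume_Ioc, ENNReal.toReal_ofReal (sub_nonneg.2 hab)]
          using this
      · rw [hR _ (lt_of_lt_of_le (by simpa using hx) (norm_fst_le (x, t₀ + h))), zero_mul]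
    · simp only [integral_const_mul]
      refine mul_le_mul_of_nonneg_left ?_ (hpos x)
      exact integral_mul_step_le hab hp (measurable_step_comp measurable_id
        (hu.measurable.comp (measurable_const.sub (hc.const_smul h))))
        (fun ξ => step_nonneg _ _) fun ξ => step_le_one _ _
  have hE2 : ∫ z, φ (z.1, t₀ + h) * (p z.2 * step z.2 (u (z.1 - h • c z.2))) ∂κ =
      ∫ z, φ (z.1 + h • c z.2, t₀ + h) * (p z.2 * step z.2 (u z.1)) ∂κ := by
    rw [integral_prod_symm _ hi1, integral_prod_symm _ hi2]
    refine integral_congr_ae (ae_of_all _ fun ξ => ?_)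
    have := integral_add_right_eq_self (μ := (volume : Measure (Space d)))
      (fun x => φ (x, t₀ + h) * (p ξ * step ξ (u (x - h • c ξ)))) (h • c ξ)
    simpa only [add_sub_cancel_right] using this.symm
  -- The increment of `φ` along characteristics.
  have hftc : ∀ z : Space d × ℝ, φ (z.1 + h • c z.2, t₀ + h) - φ (z.1, t₀) =
      ∫ s in (0 : ℝ)..h, fderiv ℝ φ (z.1 + s • c z.2, t₀ + s) (c z.2, 1) := by
    intro z
    have hd : ∀ s : ℝ, HasDerivAt (fun s : ℝ => φ (z.1 + s • c z.2, t₀ + s))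
        (fderiv ℝ φ (z.1 + s • c z.2, t₀ + s) (c z.2, 1)) s := by
      intro s
      have h1 : HasDerivAt (fun s : ℝ => ((z.1 + s • c z.2, t₀ + s) : Space d × ℝ))
          (c z.2, 1) s := by
        refine HasDerivAt.prodMk ?_ ((hasDerivAt_id s).const_add t₀)
        simpa using ((hasDerivAt_id s).smul_const (c z.2)).const_add z.1
      exact ((hφ.contDiff.differentiable one_ne_zero _).hasFDerivAt).comp_hasDerivAt s h1
    rw [intervalIntegral.integral_eq_sub_of_hasDerivAt (fun s _ => hd s)]
    · simp
    · refine Continuous.intervalIntegrable ?_ _ _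
      have h2 : Continuous fun s : ℝ =>
          (((z.1 + s • c z.2, t₀ + s), (c z.2, 1)) : (Space d × ℝ) × (Space d × ℝ)) := by fun_prop
      exact (hφ.contDiff.continuous_fderiv_apply one_ne_zero).comp h2
  have hF : Integrable (fun q : (Space d × ℝ) × ℝ => p q.1.2 * step q.1.2 (u q.1.1) *
      fderiv ℝ φ (q.1.1 + q.2 • c q.1.2, t₀ + q.2) (c q.1.2, 1))
      (κ.prod (volume.restrict (Ioc 0 h))) := by
    -- The displacement is controlled only for times in `(0, h]`, hence a bound almost everywhere.
    have hae : ∀ᵐ q ∂(κ.prod (volume.restrict (Ioc 0 h))), q.2 ∈ Ioc 0 h :=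
      Measure.quasiMeasurePreserving_snd.ae (ae_restrict_mem measurableSet_Ioc)
    have hm : Measurable (fun q : (Space d × ℝ) × ℝ => p q.1.2 * step q.1.2 (u q.1.1) *
        fderiv ℝ φ (q.1.1 + q.2 • c q.1.2, t₀ + q.2) (c q.1.2, 1)) := by
      refine (hstep.comp measurable_fst).mul (measurable_fderiv_comp hφ ?_ ?_)
      · exact ((measurable_fst.comp measurable_fst).add (measurable_snd.smul
          (hc.comp (measurable_snd.comp measurable_fst)))).prodMk (measurable_snd.const_add t₀)
      · exact (hc.comp (measurable_snd.comp measurable_fst)).prodMk measurable_const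
    have hbd : Integrable ((K ×ˢ (univ : Set ℝ)).indicator fun _ => B * (C * (L + 1)))
        (κ.prod (volume.restrict (Ioc 0 h))) := by
      refine (integrable_indicator_iff (hKm.prod MeasurableSet.univ)).2 (integrableOn_const ?_)
      rw [Measure.prod_prod]
      exact ENNReal.mul_ne_top hKμ (measure_ne_top _ _)
    refine hbd.mono' hm.aestronglyMeasurable (hae.mono fun q hq => ?_)
    by_cases hqK : q.1 ∈ K
    · rw [indicator_of_mem (by exact ⟨hqK, trivial⟩)]
      exact abs_kinDeriv_integrand_le hL hB hC' _ _ _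
    · rw [indicator_of_notMem (fun hh => hqK hh.1)]
      rw [hR' _ (lt_norm_of_displaced hL (by rw [abs_of_pos hq.1]; exact hq.2.trans hh1)
        (Or.inl (hKc _ hqK)) _)]
      simp
  calc _ ≤ (∫ z, φ (z.1 + h • c z.2, t₀ + h) * (p z.2 * step z.2 (u z.1)) ∂κ)
        - ∫ z, φ (z.1, t₀) * (p z.2 * step z.2 (u z.1)) ∂κ := by
        rw [← hE2, hE0]; exact sub_le_sub_right hE1 _
    _ = ∫ z, (∫ s in Ioc 0 h, p z.2 * step z.2 (u z.1) *
          fderiv ℝ φ (z.1 + s • c z.2, t₀ + s) (c z.2, 1)) ∂κ := by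
        rw [← integral_sub hi2 hi0]
        refine integral_congr_ae (ae_of_all _ fun z => ?_)
        simp only
        rw [integral_const_mul, ← intervalIntegral.integral_of_le hh0.le, ← hftc]
        ring
    _ = ∫ s in Ioc 0 h, (∫ z, p z.2 * step z.2 (u z.1) *
          fderiv ℝ φ (z.1 + s • c z.2, t₀ + s) (c z.2, 1) ∂κ) := integral_integral_swap hF
    _ = _ := by
        rw [intervalIntegral.integral_of_le hh0.le]
        refine integral_congr_ae (hF.prod_left_ae.mono fun s hs => ?_)
        simp only [kinDeriv]
        rw [integral_prod _ hs]

end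

/-! ### The weak form as an integral over space-time -/

/-- The part of space-time with `‖x‖ ≤ r` and `t ≤ R`. -/
def slab (d : ℕ) (r R : ℝ) : Set (SpaceTime d) :=
  Metric.closedBall 0 r ×ˢ ((↑) ⁻¹' Icc (0 : ℝ) R)

lemma volume_slab_ne_top (d : ℕ) (r R : ℝ) : volume (slab d r R) ≠ ⊤ := by
  rw [slab, Measure.volume_eq_prod, Measure.prod_prod]
  have h : IsCompact ((↑) ⁻¹' Icc (0 : ℝ) R : Set Time) :=
    isClosed_Ici.isClosedEmbedding_subtypeVal.isCompact_preimage isCompact_Icc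
  exact ENNReal.mul_ne_top measure_closedBall_lt_top.ne h.measure_lt_top.ne

lemma measurableSet_slab (d : ℕ) (r R : ℝ) : MeasurableSet (slab d r R) :=
  measurableSet_closedBall.prod (measurable_subtype_coe measurableSet_Icc)

lemma lt_or_lt_of_notMem_slab {d : ℕ} {r R : ℝ} {z : SpaceTime d} (hz : z ∉ slab d r R) :
    r < ‖z.1‖ ∨ R < |(z.2 : ℝ)| := by
  by_contra! hcon
  exact hz ⟨mem_closedBall_zero_iff.2 hcon.1, z.2.2, (le_abs_self _).trans hcon.2⟩

lemma lt_norm_of_notMem_slab {d : ℕ} {R : ℝ} {z : SpaceTime d} (hz : z ∉ slab d R R) :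
    R < ‖((z.1, (z.2 : ℝ)) : Space d × ℝ)‖ := by
  rw [Prod.norm_def, lt_max_iff]
  exact lt_or_lt_of_notMem_slab hz

lemma integral_time {E : Type*} [NormedAddCommGroup E] [NormedSpace ℝ E] (F : ℝ → E) :
    ∫ t : Time, F t = ∫ t in Ici (0 : ℝ), F t :=
  integral_subtype_comap measurableSet_Ici F

section

variable {d : ℕ} {φ : Space d × ℝ → ℝ}

lemma IsTestFunction.hasFDerivAt (hφ : IsTestFunction φ) (z : Space d × ℝ) :
    HasFDerivAt φ (fderiv ℝ φ z) z :=
  (hφ.contDiff.differentiable one_ne_zero z).hasFDerivAt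

lemma IsTestFunction.hasFDerivAt_space (hφ : IsTestFunction φ) (x : Space d) (t : ℝ) :
    HasFDerivAt (fun y : Space d => φ (y, t))
      ((fderiv ℝ φ (x, t)).comp (ContinuousLinearMap.inl ℝ (Space d) ℝ)) x :=
  (hφ.hasFDerivAt (x, t)).comp x (hasFDerivAt_prodMk_left x t)

lemma IsTestFunction.hasDerivAt_time (hφ : IsTestFunction φ) (x : Space d) (t : ℝ) :
    HasDerivAt (fun s : ℝ => φ (x, s)) (fderiv ℝ φ (x, t) (0, 1)) t :=
  (hφ.hasFDerivAt (x, t)).comp_hasDerivAt t ((hasDerivAt_const t x).prodMk (hasDerivAt_id t))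

/-- The integrand of the weak form is the derivative of the test function in the direction of the
space-time flux. -/
lemma IsTestFunction.integrand_eq (hφ : IsTestFunction φ) (x : Space d) (t α : ℝ) (β : Space d) :
    timeDeriv φ x t * α + inner ℝ (spaceGrad φ x t) β = fderiv ℝ φ (x, t) (β, α) := by
  have h1 : ((β, α) : Space d × ℝ) = (β, 0) + α • (0, 1) := by simp
  rw [h1, map_add, map_smul, timeDeriv, (hφ.hasDerivAt_time x t).deriv, spaceGrad, gradient,
    InnerProductSpace.toDual_symm_apply, (hφ.hasFDerivAt_space x t).fderiv]
  simp only [ContinuousLinearMap.comp_apply, ContinuousLinearMap.inl_apply, smul_eq_mul]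
  ring

lemma IsTestFunction.integrable_slice (hφ : IsTestFunction φ) {a₀ : Space d → ℝ}
    (ha : Measurable a₀) {M : ℝ} (hM : ∀ x, |a₀ x| ≤ M) :
    Integrable fun x => φ (x, 0) * a₀ x := by
  obtain ⟨R, C, hR0, hC0, hC, hC', hR, hR'⟩ := hφ.exists_bounds
  refine integrable_of_bdd_of_support (S := Metric.closedBall 0 R) (C := C * M)
    ((hφ.contDiff.continuous.measurable.comp (measurable_id.prodMk measurable_const)).mul ha)
    measure_closedBall_lt_top.ne (fun x => ?_) fun x hx => ?_
  · rw [abs_mul]; exact mul_le_mul (hC _) (hM _) (abs_nonneg _) hC0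
  · rw [hR _ (lt_of_lt_of_le (by simpa using hx) (norm_fst_le (x, (0 : ℝ)))), zero_mul]

lemma IsTestFunction.abs_fderiv_le {C M : ℝ} (hC : ∀ z, ‖fderiv ℝ φ z‖ ≤ C) {α : ℝ} {β : Space d}
    (hα : |α| ≤ M) (hβ : ‖β‖ ≤ M) (z : Space d × ℝ) : |fderiv ℝ φ z (β, α)| ≤ C * M := by
  refine ((fderiv ℝ φ z).le_opNorm _).trans ?_
  exact mul_le_mul (hC z) (by rw [Prod.norm_def]; exact max_le hβ hα) (norm_nonneg _)
    ((norm_nonneg _).trans (hC z))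

lemma IsTestFunction.integrable_fderiv (hφ : IsTestFunction φ) {α : SpaceTime d → ℝ}
    {β : SpaceTime d → Space d} (hα : Measurable α) (hβ : Measurable β) {M : ℝ}
    (hαM : ∀ z, |α z| ≤ M) (hβM : ∀ z, ‖β z‖ ≤ M) :
    Integrable fun z : SpaceTime d => fderiv ℝ φ (z.1, z.2) (β z, α z) := by
  obtain ⟨R, C, hR0, hC0, hC, hC', hR, hR'⟩ := hφ.exists_bounds
  refine integrable_of_bdd_of_support (S := slab d R R) (C := C * M)
    (measurable_fderiv_comp hφ (measurable_fst.prodMk (measurable_subtype_coe.comp measurable_snd))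
      (hβ.prodMk hα)) (volume_slab_ne_top d R R)
    (fun z => abs_fderiv_le hC' (hαM z) (hβM z) _) fun z hz => ?_
  rw [hR' _ (lt_norm_of_notMem_slab hz)]
  simp

lemma IsTestFunction.weakForm_eq (hφ : IsTestFunction φ) {α : SpaceTime d → ℝ}
    {β : SpaceTime d → Space d} (hα : Measurable α) (hβ : Measurable β) {M : ℝ}
    (hαM : ∀ z, |α z| ≤ M) (hβM : ∀ z, ‖β z‖ ≤ M) (a₀ : Space d → ℝ) :
    weakForm α β a₀ φ =
      (∫ z : SpaceTime d, fderiv ℝ φ (z.1, z.2) (β z, α z)) + ∫ x, φ (x, 0) * a₀ x := by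
  unfold weakForm
  congr 1
  have := integral_prod_symm (μ := (volume : Measure (Space d))) (ν := (volume : Measure Time)) _
    (hφ.integrable_fderiv hα hβ hαM hβM)
  rw [Measure.volume_eq_prod, this]
  simp only [hφ.integrand_eq]

/-- Constants are solutions. -/
lemma IsTestFunction.weakForm_const (hφ : IsTestFunction φ) (α : ℝ) (β : Space d) :
    weakForm (fun _ => α) (fun _ => β) (fun _ => α) φ = 0 := by
  obtain ⟨R, C, hR0, hC0, hC, hC', hR, hR'⟩ := hφ.exists_bounds
  have hM : ∀ _ : SpaceTime d, |α| ≤ |α| + ‖β‖ := fun _ => by linarith [norm_nonneg β]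
  have hM' : ∀ _ : SpaceTime d, ‖β‖ ≤ |α| + ‖β‖ := fun _ => by linarith [abs_nonneg α]
  have hM0 : ∀ _ : SpaceTime d, |(0 : ℝ)| ≤ |α| + ‖β‖ := fun _ => by rw [abs_zero]; positivity
  have hM0' : ∀ _ : SpaceTime d, ‖(0 : Space d)‖ ≤ |α| + ‖β‖ := fun _ => by
    rw [norm_zero]; positivity
  rw [hφ.weakForm_eq measurable_const measurable_const hM hM']
  have hspace := hφ.integrable_fderiv measurable_const measurable_const hM0 hM'
  have htime := hφ.integrable_fderiv measurable_const measurable_const hM hM0'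
  have hsplit : ∀ z : SpaceTime d, fderiv ℝ φ (z.1, z.2) (β, α) =
      fderiv ℝ φ (z.1, z.2) (β, 0) + fderiv ℝ φ (z.1, z.2) (0, α) := fun z => by
    rw [← map_add]; simp
  have h1 : ∫ z : SpaceTime d, fderiv ℝ φ (z.1, z.2) (β, 0) = 0 := by
    have := integral_prod_symm (μ := (volume : Measure (Space d)))
      (ν := (volume : Measure Time)) _ hspace
    rw [Measure.volume_eq_prod, this]
    refine integral_eq_zero_of_ae (ae_of_all _ fun t => ?_)
    have hi1 : Integrable fun x : Space d => φ (x, (t : ℝ)) := by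
      refine integrable_of_bdd_of_support (S := Metric.closedBall 0 R) (C := C)
        (hφ.contDiff.continuous.measurable.comp (measurable_id.prodMk measurable_const))
        measure_closedBall_lt_top.ne (fun x => hC _) fun x hx => ?_
      exact hR _ (lt_of_lt_of_le (by simpa using hx) (norm_fst_le (x, (t : ℝ))))
    have hi2 : Integrable fun x : Space d => fderiv ℝ φ (x, (t : ℝ)) (β, 0) := by
      refine integrable_of_bdd_of_support (S := Metric.closedBall 0 R) (C := C * ‖β‖)
        (measurable_fderiv_comp hφ (measurable_id.prodMk measurable_const) measurable_const)
        measure_closedBall_lt_top.ne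
        (fun x => abs_fderiv_le hC' (by simp) le_rfl _) fun x hx => ?_
      rw [hR' _ (lt_of_lt_of_le (by simpa using hx) (norm_fst_le (x, (t : ℝ))))]
      simp
    have hfd : ∀ x : Space d, fderiv ℝ (fun y : Space d => φ (y, (t : ℝ))) x β =
        fderiv ℝ φ (x, (t : ℝ)) (β, 0) := fun x => by
      rw [(hφ.hasFDerivAt_space x t).fderiv]; simp
    have h := integral_mul_fderiv_eq_neg_fderiv_mul_of_integrable (𝕜 := ℝ)
      (μ := (volume : Measure (Space d))) (f := fun _ => (1 : ℝ))
      (g := fun y : Space d => φ (y, (t : ℝ))) (v := β) (by simp) (by simpa [hfd] using hi2)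
      (by simpa using hi1) (fun x _ => differentiableAt_const _)
      (fun x _ => (hφ.hasFDerivAt_space x t).differentiableAt)
    simpa [hfd] using h
  have h2 : ∫ z : SpaceTime d, fderiv ℝ φ (z.1, z.2) (0, α) = - ∫ x, φ (x, 0) * α := by
    rw [Measure.volume_eq_prod, integral_prod _ htime, ← integral_neg]
    refine integral_congr_ae (ae_of_all _ fun x => ?_)
    have hd : ∀ t : ℝ, fderiv ℝ φ (x, t) (0, α) = α * deriv (fun s : ℝ => φ (x, s)) t := by
      intro t
      rw [(hφ.hasDerivAt_time x t).deriv, ← smul_eq_mul, ← map_smul]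
      simp
    have hcs : HasCompactSupport fun s : ℝ => φ (x, s) := by
      refine HasCompactSupport.intro (isCompact_closedBall (0 : ℝ) R) fun s hs => ?_
      exact hR _ (lt_of_lt_of_le (by simpa using hs) (norm_snd_le (x, s)))
    have hcd : ContDiff ℝ 1 fun s : ℝ => φ (x, s) :=
      hφ.contDiff.comp (contDiff_const.prodMk contDiff_id)
    simp only [hd]
    rw [integral_const_mul, integral_time (fun t => deriv (fun s : ℝ => φ (x, s)) t),
      integral_Ici_eq_integral_Ioi, hcs.integral_Ioi_deriv_eq hcd]
    ring
  simp only [hsplit]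
  rw [integral_add hspace htime, h1, h2]
  ring

lemma IsTestFunction.weakForm_add {ψ : Space d × ℝ → ℝ} (hφ : IsTestFunction φ)
    (hψ : IsTestFunction ψ) {α : SpaceTime d → ℝ}
    {β : SpaceTime d → Space d} (hα : Measurable α) (hβ : Measurable β) {M : ℝ}
    (hαM : ∀ z, |α z| ≤ M) (hβM : ∀ z, ‖β z‖ ≤ M) {a₀ : Space d → ℝ}
    (ha : Measurable a₀) (haM : ∀ x, |a₀ x| ≤ M) :
    IsTestFunction (φ + ψ) ∧
      weakForm α β a₀ (φ + ψ) = weakForm α β a₀ φ + weakForm α β a₀ ψ := by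
  have hs : IsTestFunction (φ + ψ) :=
    ⟨hφ.contDiff.add hψ.contDiff, hφ.compactSupport.add hψ.compactSupport⟩
  refine ⟨hs, ?_⟩
  rw [hs.weakForm_eq hα hβ hαM hβM, hφ.weakForm_eq hα hβ hαM hβM, hψ.weakForm_eq hα hβ hαM hβM]
  have h1 : ∀ z, fderiv ℝ (φ + ψ) z = fderiv ℝ φ z + fderiv ℝ ψ z := fun z =>
    ((hφ.hasFDerivAt z).add (hψ.hasFDerivAt z)).fderiv
  simp only [h1, Pi.add_apply, _root_.add_apply, add_mul]
  rw [integral_add (hφ.integrable_fderiv hα hβ hαM hβM) (hψ.integrable_fderiv hα hβ hαM hβM),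
    integral_add (hφ.integrable_slice ha haM) (hψ.integrable_slice ha haM)]
  ring

/-- A test function becomes nonnegative by the addition of a nonnegative test function. -/
lemma IsTestFunction.exists_add_nonneg (hφ : IsTestFunction φ) :
    ∃ ψ : Space d × ℝ → ℝ, IsTestFunction ψ ∧ (∀ z, 0 ≤ ψ z) ∧ ∀ z, 0 ≤ (φ + ψ) z := by
  obtain ⟨R, C, hR0, hC0, hC, hC', hR, hR'⟩ := hφ.exists_bounds
  let χ : ContDiffBump (0 : Space d × ℝ) := ⟨R + 1, R + 2, by linarith, by linarith⟩
  refine ⟨fun z => C * χ z, ⟨contDiff_const.mul χ.contDiff, χ.hasCompactSupport.mul_left⟩,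
    fun z => mul_nonneg hC0 χ.nonneg, fun z => ?_⟩
  rw [Pi.add_apply]
  by_cases hz : R < ‖z‖
  · rw [hR z hz, zero_add]; exact mul_nonneg hC0 χ.nonneg
  · have h1 : χ z = 1 := χ.one_of_mem_closedBall (by
      rw [mem_closedBall_zero_iff]; change ‖z‖ ≤ R + 1; linarith)
    rw [h1]
    linarith [(abs_le.1 (hC z)).1]

end

/-! ### Limits of the approximate solutions are entropy solutions -/

section

variable {d : ℕ} {c : ℝ → Space d} {a b h L B : ℝ} {p : ℝ → ℝ} {φ : Space d × ℝ → ℝ}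

lemma measurable_approx (hc : Measurable c) {u₀ : Space d → ℝ} (hu : Measurable u₀) :
    Measurable fun z : SpaceTime d => approx c a b h u₀ z.2 z.1 :=
  (measurable_approx_param (Ω := Unit) hc (u := fun _ => u₀) (hu.comp measurable_snd)).comp
    (measurable_const.prodMk (measurable_fst.prodMk (measurable_subtype_coe.comp measurable_snd)) :
      Measurable fun z : SpaceTime d => ((), z.1, (z.2 : ℝ)))

/-- The time elapsed at `t` since the last time step. -/
noncomputable def lag (h t : ℝ) : ℝ := t - ⌊t / h⌋₊ * h

lemma lag_mem {t : ℝ} (hh : 0 < h) (ht : 0 ≤ t) : lag h t ∈ Icc 0 h := by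
  have h1 := floor_div_mul_le hh ht
  have h2 : t < (⌊t / h⌋₊ + 1) * h := (div_lt_iff₀ hh).1 (Nat.lt_floor_add_one _)
  constructor <;> unfold lag <;> linarith

lemma measurable_lag (h : ℝ) : Measurable (lag h) := by
  have : Measurable fun t : ℝ => (⌊t / h⌋₊ : ℝ) :=
    (measurable_from_top (f := fun n : ℕ => (n : ℝ))).comp
      (Nat.measurable_floor.comp (measurable_id.div_const h))
  exact measurable_id.sub (this.mul_const h)

lemma integrable_kinDeriv (hab : a ≤ b) (hc : Measurable c) (hL : ∀ ξ, ‖c ξ‖ ≤ L)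
    (hp : Measurable p) (hB : ∀ ξ, |p ξ| ≤ B) (hφ : IsTestFunction φ) {v s : SpaceTime d → ℝ}
    (hv : Measurable v) (hs : Measurable s) (hs1 : ∀ z, |s z| ≤ 1) :
    Integrable fun z : SpaceTime d => kinDeriv c p a b φ (v z) (s z) z.1 z.2 := by
  obtain ⟨R, C, hR0, hC0, hC, hC', hR, hR'⟩ := hφ.exists_bounds
  exact integrable_of_bdd_of_support (S := slab d (R + L) R)
    (measurable_kinDeriv hc hp hφ hv hs measurable_fst
      (measurable_subtype_coe.comp measurable_snd)) (volume_slab_ne_top d _ _)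
    (fun z => abs_kinDeriv_le hab hL hB hC' _ _ _ _)
    fun z hz => kinDeriv_eq_zero hL hR' (hs1 z) (lt_or_lt_of_notMem_slab hz) _

/-- The entropy inequality for the approximate solutions. The test function is differentiated at
points displaced along characteristics by at most the distance travelled in one time step. -/
lemma approx_entropy_ineq (hab : a ≤ b) (hc : Measurable c) (hL : ∀ ξ, ‖c ξ‖ ≤ L) (hp : Monotone p)
    (hB : ∀ ξ, |p ξ| ≤ B) (hφ : IsTestFunction φ) (hh0 : 0 < h) (hh1 : h ≤ 1)
    (hpos : ∀ x t, 0 ≤ t → 0 ≤ φ (x, t)) {u₀ : Space d → ℝ} (hu : Admissible a b u₀) :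
    0 ≤ (∫ z : SpaceTime d, kinDeriv c p a b φ (approx c a b h u₀ z.2 z.1) (lag h z.2) z.1 z.2)
      + ∫ x, φ (x, 0) * kinEntropy p a b (u₀ x) := by
  obtain ⟨R, C, hR0, hC0, hC, hC', hR, hR'⟩ := hφ.exists_bounds
  set J : ℝ → ℝ := fun t => ∫ y, kinDeriv c p a b φ (approx c a b h u₀ t y) (lag h t) y t with hJ
  have hlag : ∀ t : Time, |lag h t| ≤ 1 := fun t => by
    obtain ⟨h1, h2⟩ := lag_mem hh0 t.2
    rw [abs_of_nonneg h1]; exact h2.trans hh1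
  have hint := integrable_kinDeriv hab hc hL hp.measurable hB hφ
    (measurable_approx (h := h) (a := a) (b := b) hc hu.measurable)
    ((measurable_lag h).comp (measurable_subtype_coe.comp measurable_snd)) fun z => hlag z.2
  have hst : ∫ z : SpaceTime d,
      kinDeriv c p a b φ (approx c a b h u₀ z.2 z.1) (lag h z.2) z.1 z.2 =
        ∫ t in Ici (0 : ℝ), J t := by
    rw [← integral_time, Measure.volume_eq_prod]
    exact integral_prod_symm _ hint
  have hJi : IntegrableOn J (Ici 0) := by
    rw [integrableOn_iff_comap_subtypeVal measurableSet_Ici]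
    exact Integrable.integral_prod_right hint
  have hJ0 : ∀ t, R < t → 0 ≤ t → J t = 0 := by
    intro t ht ht0
    refine integral_eq_zero_of_ae (ae_of_all _ fun y => ?_)
    exact kinDeriv_eq_zero hL hR' (hlag ⟨t, ht0⟩) (Or.inr (ht.trans_le (le_abs_self t))) _
  set A : ℕ → ℝ := fun n =>
    ∫ x, φ (x, n * h) * kinEntropy p a b ((collapse c a b h)^[n] u₀ x) with hA
  have hstep : ∀ n : ℕ, A (n + 1) - A n ≤ ∫ t in (n * h : ℝ)..((n + 1 : ℕ) * h : ℝ), J t := by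
    intro n
    have hn : ((n + 1 : ℕ) : ℝ) * h = n * h + h := by push_cast; ring
    have h1 := entropy_step_le hab hc hL hp hB hφ hh0 hh1 (t₀ := n * h)
      (fun x => hpos x _ (by positivity)) (hu.iterate hab hc n (h := h))
    simp only [hA, hn, Function.iterate_succ_apply']
    refine h1.trans (le_of_eq ?_)
    have h2 := intervalIntegral.integral_comp_add_left (a := 0) (b := h) J (n * h)
    rw [add_zero] at h2
    rw [← h2, intervalIntegral.integral_of_le hh0.le, intervalIntegral.integral_of_le hh0.le,
      integral_Ioc_eq_integral_Ioo, integral_Ioc_eq_integral_Ioo]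
    refine setIntegral_congr_fun measurableSet_Ioo fun s hs => ?_
    have hfl : ⌊(n * h + s) / h⌋₊ = n := by
      rw [Nat.floor_eq_iff (by have := hs.1; positivity), le_div_iff₀ hh0, div_lt_iff₀ hh0]
      constructor <;> nlinarith [hs.1, hs.2]
    simp only [hJ, approx, lag, hfl, add_sub_cancel_left]
  obtain ⟨N, hN⟩ := exists_nat_gt (R / h)
  have hRN : R < N * h := (div_lt_iff₀ hh0).1 hN
  have hN0 : (0 : ℝ) ≤ N * h := by positivity
  have hAN : A N = 0 := by
    refine integral_eq_zero_of_ae (ae_of_all _ fun x => ?_)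
    have : R < ‖((x, N * h) : Space d × ℝ)‖ := by
      refine hRN.trans_le ((le_abs_self _).trans ?_)
      exact norm_snd_le (x, (N * h : ℝ))
    simp only [hR _ this, zero_mul, Pi.zero_apply]
  have hsum : A N - A 0 ≤ ∫ t in (0 : ℝ)..(N * h), J t := by
    have h1 := intervalIntegral.sum_integral_adjacent_intervals (f := J) (μ := volume)
      (a := fun n : ℕ => (n * h : ℝ)) (n := N) fun k _ => by
        have hk : (k * h : ℝ) ≤ (k + 1 : ℕ) * h := by gcongr; omega
        rw [intervalIntegrable_iff_integrableOn_Ioc_of_le hk]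
        exact hJi.mono_set fun t ht => le_trans (by positivity) ht.1.le
    simp only [Nat.cast_zero, zero_mul] at h1
    rw [← h1, ← Finset.sum_range_sub]
    exact Finset.sum_le_sum fun n _ => hstep n
  have htail : ∫ t in (0 : ℝ)..(N * h), J t = ∫ t in Ici (0 : ℝ), J t := by
    rw [intervalIntegral.integral_of_le hN0, integral_Ici_eq_integral_Ioi]
    refine (setIntegral_eq_of_subset_of_forall_sdiff_eq_zero measurableSet_Ioi
      (fun t ht => ht.1) fun t ht => ?_).symm
    have ht0 : (0 : ℝ) < t := ht.1
    have : N * h < t := by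
      by_contra hcon
      exact ht.2 ⟨ht0, not_lt.1 hcon⟩
    exact hJ0 t (hRN.trans this) ht0.le
  have hA0 : A 0 = ∫ x, φ (x, 0) * kinEntropy p a b (u₀ x) := by simp [hA]
  rw [hst, ← htail, ← hA0]
  linarith

lemma tendsto_step {v : ℕ → ℝ} {w ξ : ℝ} (hv : Tendsto v atTop (𝓝 w)) (hξ : ξ ≠ w) :
    Tendsto (fun k => step ξ (v k)) atTop (𝓝 (step ξ w)) := by
  refine tendsto_const_nhds.congr' ?_
  rcases lt_or_gt_of_ne hξ with h | h
  · filter_upwards [hv.eventually_const_lt h] with k hk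
    simp [step, h, hk]
  · filter_upwards [hv.eventually_lt_const h] with k hk
    simp [step, not_lt.2 h.le, not_lt.2 hk.le]

/-- The kinetic function is discontinuous in the value `w` only at `ξ = w`, a null set of `ξ`. -/
lemma tendsto_kinDeriv (hc : Measurable c) (hL : ∀ ξ, ‖c ξ‖ ≤ L) (hp : Measurable p)
    (hB : ∀ ξ, |p ξ| ≤ B) (hφ : IsTestFunction φ) {v s : ℕ → ℝ} {w : ℝ}
    (hv : Tendsto v atTop (𝓝 w)) (hs : Tendsto s atTop (𝓝 0)) (y : Space d) (t : ℝ) :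
    Tendsto (fun k => kinDeriv c p a b φ (v k) (s k) y t) atTop
      (𝓝 (kinDeriv c p a b φ w 0 y t)) := by
  obtain ⟨R, C, hR0, hC0, hC, hC', hR, hR'⟩ := hφ.exists_bounds
  refine tendsto_integral_of_dominated_convergence (fun _ => B * (C * (L + 1))) (fun k => ?_)
    (integrable_const _) (fun k => ae_of_all _ fun ξ => ?_) ?_
  · have h1 : Measurable fun ξ => p ξ * step ξ (v k) :=
      hp.mul (measurable_step_comp measurable_id measurable_const)
    have h2 : Measurable fun ξ => ((y + s k • c ξ, t) : Space d × ℝ) :=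
      ((hc.const_smul (s k)).const_add y).prodMk measurable_const
    have h3 : Measurable fun ξ => ((c ξ, 1) : Space d × ℝ) := hc.prodMk measurable_const
    exact (h1.mul (measurable_fderiv_comp hφ h2 h3)).aestronglyMeasurable
  · exact abs_kinDeriv_integrand_le hL hB hC' _ ξ _
  · have hne : ∀ᵐ ξ ∂(volume.restrict (Ioc a b)), ξ ≠ w :=
      ae_restrict_of_ae (Measure.ae_ne volume w)
    filter_upwards [hne] with ξ hξ
    refine ((tendsto_step hv hξ).const_mul _).mul ?_
    have h1 : Continuous fun r : ℝ => fderiv ℝ φ (y + r • c ξ, t) (c ξ, 1) := by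
      have h2 : Continuous fun r : ℝ =>
          (((y + r • c ξ, t), (c ξ, 1)) : (Space d × ℝ) × (Space d × ℝ)) := by fun_prop
      exact (hφ.contDiff.continuous_fderiv_apply one_ne_zero).comp h2
    exact (h1.tendsto 0).comp hs

lemma limit_entropy_ineq (hab : a ≤ b) (hc : Measurable c) (hL : ∀ ξ, ‖c ξ‖ ≤ L) (hp : Monotone p)
    (hB : ∀ ξ, |p ξ| ≤ B) (hφ : IsTestFunction φ)
    (hpos : ∀ x t, 0 ≤ t → 0 ≤ φ (x, t)) {u₀ : Space d → ℝ} (hu₀ : Admissible a b u₀)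
    {h : ℕ → ℝ} (hh0 : ∀ k, 0 < h k) (hh1 : ∀ k, h k ≤ 1) (hh : Tendsto h atTop (𝓝 0))
    {u : SpaceTime d → ℝ}
    (hlim : ∀ᵐ z : SpaceTime d, Tendsto (fun k => approx c a b (h k) u₀ z.2 z.1) atTop (𝓝 (u z))) :
    0 ≤ (∫ z : SpaceTime d, kinDeriv c p a b φ (u z) 0 z.1 z.2)
      + ∫ x, φ (x, 0) * kinEntropy p a b (u₀ x) := by
  obtain ⟨R, C, hR0, hC0, hC, hC', hR, hR'⟩ := hφ.exists_bounds
  refine ge_of_tendsto' (x := atTop) (Tendsto.add_const _ ?_) fun k =>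
    approx_entropy_ineq hab hc hL hp hB hφ (hh0 k) (hh1 k) hpos hu₀
  have hlag : ∀ k (t : Time), |lag (h k) t| ≤ 1 := fun k t => by
    obtain ⟨h1, h2⟩ := lag_mem (hh0 k) t.2
    rw [abs_of_nonneg h1]; exact h2.trans (hh1 k)
  have hbd : Integrable ((slab d (R + L) R).indicator fun _ => B * (C * (L + 1)) * (b - a)) :=
    (integrable_indicator_iff (measurableSet_slab d _ _)).2
      (integrableOn_const (volume_slab_ne_top d _ _))
  refine tendsto_integral_of_dominated_convergence _ (fun k => ?_) hbd
    (fun k => ae_of_all _ fun z => ?_) ?_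
  · exact (integrable_kinDeriv hab hc hL hp.measurable hB hφ
      (measurable_approx hc hu₀.measurable)
      ((measurable_lag (h k)).comp (measurable_subtype_coe.comp measurable_snd))
      fun z => hlag k z.2).aestronglyMeasurable
  · by_cases hz : z ∈ slab d (R + L) R
    · rw [indicator_of_mem hz]
      exact abs_kinDeriv_le hab hL hB hC' _ _ _ _
    · rw [indicator_of_notMem hz,
        kinDeriv_eq_zero hL hR' (hlag k z.2) (lt_or_lt_of_notMem_slab hz), norm_zero]
  · filter_upwards [hlim] with z hz
    refine tendsto_kinDeriv hc hL hp.measurable hB hφ hz ?_ _ _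
    exact squeeze_zero (fun k => (lag_mem (hh0 k) z.2.2).1) (fun k => (lag_mem (hh0 k) z.2.2).2) hh

end

/-- The characteristic speed, frozen outside of `[a, b]` to make it bounded. -/
noncomputable def speed {d : ℕ} (f : ℝ → Space d) (a b ξ : ℝ) : Space d :=
  deriv f (max a (min b ξ))

lemma continuous_speed {d : ℕ} {f : ℝ → Space d} (hf : ContDiff ℝ 1 f) (a b : ℝ) :
    Continuous (speed f a b) :=
  (hf.continuous_deriv le_rfl).comp (by fun_prop)

lemma clamp_eq {a b ξ : ℝ} (hξ : ξ ∈ Icc a b) : max a (min b ξ) = ξ := by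
  rw [min_eq_right hξ.2, max_eq_right hξ.1]

lemma clamp_mem {a b : ℝ} (hab : a ≤ b) (ξ : ℝ) : max a (min b ξ) ∈ Icc a b :=
  ⟨le_max_left _ _, max_le hab (min_le_left _ _)⟩

lemma exists_speed_le {d : ℕ} {f : ℝ → Space d} (hf : ContDiff ℝ 1 f) {a b : ℝ} (hab : a ≤ b) :
    ∃ L, 0 ≤ L ∧ ∀ ξ, ‖speed f a b ξ‖ ≤ L := by
  obtain ⟨L, hL⟩ := (isCompact_Icc (a := a) (b := b)).exists_bound_of_continuousOn
    (hf.continuous_deriv le_rfl).continuousOn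
  exact ⟨L, (norm_nonneg _).trans (hL a ⟨le_rfl, hab⟩), fun ξ => hL _ (clamp_mem hab ξ)⟩

lemma isEntropyPair_id {d : ℕ} {f : ℝ → Space d} (hf : ContDiff ℝ 1 f) :
    IsEntropyPair f (fun ξ => ξ) f := by
  refine ⟨convexOn_id convex_univ, fun a b => ?_⟩
  simp only [deriv_id'', one_smul]
  rw [intervalIntegral.integral_deriv_eq_sub
    (fun x _ => hf.differentiable one_ne_zero x)
    ((hf.continuous_deriv le_rfl).intervalIntegrable _ _)]

lemma isEntropyPair_neg_id {d : ℕ} {f : ℝ → Space d} (hf : ContDiff ℝ 1 f) :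
    IsEntropyPair f (fun ξ => -ξ) (fun ξ => -f ξ) := by
  refine ⟨(concaveOn_id convex_univ).neg, fun a b => ?_⟩
  have h := (isEntropyPair_id hf).compat a b
  simp only [deriv_id'', one_smul] at h
  simp only [deriv_neg'', neg_smul, one_smul, intervalIntegral.integral_neg, ← h]
  abel

lemma exists_norm_le_on {E : Type*} [NormedAddCommGroup E] {g : ℝ → E} (hg : Continuous g)
    (a b : ℝ) : ∃ M, ∀ v ∈ Icc a b, ‖g v‖ ≤ M :=
  (isCompact_Icc (a := a) (b := b)).exists_bound_of_continuousOn hg.continuousOn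

lemma weakForm_neg {d : ℕ} (α : SpaceTime d → ℝ) (β : SpaceTime d → Space d) (a₀ : Space d → ℝ)
    (φ : Space d × ℝ → ℝ) :
    weakForm (fun z => -α z) (fun z => -β z) (fun x => -a₀ x) φ = -weakForm α β a₀ φ := by
  unfold weakForm
  simp only [mul_neg, inner_neg_right, ← neg_add, integral_neg]

/-- The integrand of the weak form at an entropy pair `(η, q)`, in kinetic variables: the constants
`(η(a), q(a))` split off, and freezing speed and weight outside of `[a, b]` is harmless. -/
lemma fderiv_entropyPair_eq {d : ℕ} {f : ℝ → Space d} {a b : ℝ} {φ : Space d × ℝ → ℝ}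
    {η : ℝ → ℝ} {q : ℝ → Space d} {p : ℝ → ℝ} (hf : ContDiff ℝ 1 f) (hp : Monotone p)
    {v : ℝ} (hη : η v - η a = ∫ ξ in Ioc a b, p ξ * step ξ v)
    (hq : q v - q a = ∫ ξ in Ioc a b, (p ξ * step ξ v) • deriv f ξ) (x : Space d) (t : ℝ) :
    fderiv ℝ φ (x, t) (q v, η v) = fderiv ℝ φ (x, t) (q a, η a) +
      kinDeriv (speed f a b) (fun ξ => p (max a (min b ξ))) a b φ v 0 x t := by
  have hpi : Integrable p (volume.restrict (Ioc a b)) :=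
    (hp.locallyIntegrable.integrableOn_isCompact isCompact_Icc).mono_set Ioc_subset_Icc_self
  have hps : Integrable (fun ξ => p ξ * step ξ v) (volume.restrict (Ioc a b)) :=
    hpi.mul_bdd (c := 1) (measurable_step_comp measurable_id measurable_const).aestronglyMeasurable
      (ae_of_all _ fun ξ => by simpa using abs_step_le_one ξ v)
  obtain ⟨L, hL⟩ := exists_norm_le_on (hf.continuous_deriv le_rfl) a b
  have hps' : Integrable (fun ξ => (p ξ * step ξ v) • deriv f ξ) (volume.restrict (Ioc a b)) :=
    hps.smul_bdd L (hf.continuous_deriv le_rfl).aestronglyMeasurable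
      ((ae_restrict_mem measurableSet_Ioc).mono fun ξ hξ => hL ξ (Ioc_subset_Icc_self hξ))
  have h1 : kinDeriv (speed f a b) (fun ξ => p (max a (min b ξ))) a b φ v 0 x t =
      ∫ ξ in Ioc a b, fderiv ℝ φ (x, t) ((p ξ * step ξ v) • deriv f ξ, p ξ * step ξ v) := by
    refine setIntegral_congr_fun measurableSet_Ioc fun ξ hξ => ?_
    simp only [speed, clamp_eq (Ioc_subset_Icc_self hξ), zero_smul, add_zero]
    rw [← smul_eq_mul (p ξ * step ξ v) (fderiv ℝ φ (x, t) _), ← map_smul]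
    simp
  rw [h1, ContinuousLinearMap.integral_comp_comm _ (hps'.prodMk hps),
    integral_pair hps' hps, ← hη, ← hq, ← map_add]
  simp

theorem isEntropySolution_of_tendsto {d : ℕ} {f : ℝ → Space d} (hf : ContDiff ℝ 1 f) {a b : ℝ}
    (hab : a ≤ b) {u₀ : Space d → ℝ} (hu₀ : Admissible a b u₀)
    {h : ℕ → ℝ} (hh0 : ∀ k, 0 < h k) (hh1 : ∀ k, h k ≤ 1) (hh : Tendsto h atTop (𝓝 0))
    {u : SpaceTime d → ℝ} (hu : Measurable u) (humem : ∀ z, u z ∈ Icc a b)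
    (hlim : ∀ᵐ z : SpaceTime d,
      Tendsto (fun k => approx (speed f a b) a b (h k) u₀ z.2 z.1) atTop (𝓝 (u z))) :
    IsEntropySolution f u₀ u := by
  obtain ⟨L, hL0, hL⟩ := exists_speed_le hf hab
  have hineq : ∀ (η : ℝ → ℝ) (q : ℝ → Space d), IsEntropyPair f η q →
      ∀ φ : Space d × ℝ → ℝ, IsTestFunction φ → (∀ (x : Space d) (t : ℝ), 0 ≤ t → 0 ≤ φ (x, t)) →
      0 ≤ weakForm (fun z => η (u z)) (fun z => q (u z)) (fun x => η (u₀ x)) φ := by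
    intro η q hηq φ hφ hpos
    obtain ⟨p, hp, hrep⟩ := hηq.exists_kinetic
    have hηc := hηq.continuous_entropy
    have hqc := hηq.continuous_flux hf
    obtain ⟨M₁, hM₁⟩ := exists_norm_le_on hηc a b
    obtain ⟨M₂, hM₂⟩ := exists_norm_le_on hqc a b
    set p' : ℝ → ℝ := fun ξ => p (max a (min b ξ)) with hp'
    have hp'm : Monotone p' := fun x y hxy => hp (max_le_max le_rfl (min_le_min le_rfl hxy))
    have hp'B : ∀ ξ, |p' ξ| ≤ |p a| + |p b| := fun ξ => abs_le_of_monotone hp (clamp_mem hab ξ)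
    have key := limit_entropy_ineq hab (continuous_speed hf a b).measurable hL hp'm hp'B hφ hpos
      hu₀ hh0 hh1 hh hlim
    have hamem : a ∈ Icc a b := ⟨le_rfl, hab⟩
    have hconst := hφ.weakForm_const (η a) (q a)
    rw [hφ.weakForm_eq (M := max M₁ M₂) measurable_const measurable_const
      (fun _ => (hM₁ a hamem).trans (le_max_left _ _))
      (fun _ => (hM₂ a hamem).trans (le_max_right _ _))] at hconst
    rw [hφ.weakForm_eq (M := max M₁ M₂) (α := fun z => η (u z))
      (β := fun z => q (u z)) (hηc.measurable.comp hu) (hqc.measurable.comp hu)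
      (fun z => (hM₁ _ (humem z)).trans (le_max_left _ _))
      (fun z => (hM₂ _ (humem z)).trans (le_max_right _ _))]
    have h1 : ∫ z : SpaceTime d, fderiv ℝ φ (z.1, z.2) (q (u z), η (u z)) =
        (∫ z : SpaceTime d, fderiv ℝ φ (z.1, z.2) (q a, η a)) +
          ∫ z : SpaceTime d, kinDeriv (speed f a b) p' a b φ (u z) 0 z.1 z.2 := by
      rw [← integral_add (hφ.integrable_fderiv (M := max M₁ M₂) measurable_const measurable_const
          (fun _ => (hM₁ a hamem).trans (le_max_left _ _))
          (fun _ => (hM₂ a hamem).trans (le_max_right _ _)))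
        (integrable_kinDeriv hab (continuous_speed hf a b).measurable hL hp'm.measurable hp'B hφ hu
          measurable_const (by simp))]
      refine integral_congr_ae (ae_of_all _ fun z => ?_)
      have := hrep a b (u z) (humem z)
      exact fderiv_entropyPair_eq hf hp this.1 this.2 z.1 z.2
    have h2 : ∫ x, φ (x, 0) * η (u₀ x) =
        (∫ x, φ (x, 0) * η a) + ∫ x, φ (x, 0) * kinEntropy p' a b (u₀ x) := by
      have hk : ∀ x, kinEntropy p' a b (u₀ x) = η (u₀ x) - η a := fun x => by
        rw [(hrep a b _ (hu₀.mem x)).1]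
        refine setIntegral_congr_fun measurableSet_Ioc fun ξ hξ => ?_
        simp only [hp', clamp_eq (Ioc_subset_Icc_self hξ)]
      simp only [hk, mul_sub]
      rw [integral_sub (hφ.integrable_slice (a₀ := fun x => η (u₀ x))
        (hηc.measurable.comp hu₀.measurable)
        fun x => hM₁ _ (hu₀.mem x)) (hφ.integrable_slice measurable_const
        fun x => hM₁ _ hamem)]
      ring
    rw [h1, h2]
    linarith
  have habs : ∀ v ∈ Icc a b, |v| ≤ |a| + |b| := fun v hv => abs_le_of_monotone monotone_id hv
  refine ⟨⟨memLp_top_of_bound hu₀.measurable.aestronglyMeasurable (|a| + |b|)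
      (ae_of_all _ fun x => habs _ (hu₀.mem x)),
    memLp_top_of_bound hu.aestronglyMeasurable (|a| + |b|)
      (ae_of_all _ fun x => habs _ (humem x)), ?_⟩, hineq⟩
  -- The weak equation follows from the inequalities for the entropies `± id`.
  have hzero : ∀ φ : Space d × ℝ → ℝ, IsTestFunction φ → (∀ z, 0 ≤ φ z) →
      weakForm u (fun z => f (u z)) u₀ φ = 0 := by
    intro φ hφ hpos
    have h1 := hineq _ _ (isEntropyPair_id hf) φ hφ fun x t _ => hpos _
    have h2 := hineq _ _ (isEntropyPair_neg_id hf) φ hφ fun x t _ => hpos _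
    rw [weakForm_neg] at h2
    linarith
  intro φ hφ
  obtain ⟨ψ, hψ, hψ0, hφψ⟩ := hφ.exists_add_nonneg
  obtain ⟨M, hM⟩ := exists_norm_le_on hf.continuous a b
  obtain ⟨hs, hadd⟩ := hφ.weakForm_add (M := max (|a| + |b|) M) hψ hu
    (hf.continuous.measurable.comp hu)
    (fun z => (habs _ (humem z)).trans (le_max_left _ _))
    (fun z => (hM _ (humem z)).trans (le_max_right _ _)) hu₀.measurable
    (fun x => (habs _ (hu₀.mem x)).trans (le_max_left _ _))
  have h1 := hzero _ hs hφψ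
  have h2 := hzero _ hψ hψ0
  simp only [Function.comp_def] at hadd
  linarith

/-! ### Random data and random approximate solutions -/

/-- Weak* measurability against `C₀` implies measurability as a family of measures. -/
lemma YoungMeasure.measurable_measureAt {Z : Type*} [MeasurableSpace Z] (σ : YoungMeasure Z) :
    Measurable σ.measureAt := by
  have : ∀ z, IsProbabilityMeasure (σ.measureAt z) := fun z => (σ.toFun z).2
  refine Measurable.measure_of_isPiSystem_of_isProbabilityMeasure
    (BorelSpace.measurable_eq.trans Real.borel_eq_generateFrom_Ioo_rat) Real.isPiSystem_Ioo_rat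
    fun s hs => ?_
  simp only [mem_iUnion, mem_singleton_iff] at hs
  obtain ⟨p, q, -, rfl⟩ := hs
  -- Tent functions increasing to the indicator of `(p, q)`.
  let g : ℕ → ℝ → ℝ := fun n ξ => max 0 (min 1 (n * min (ξ - p) (q - ξ)))
  have hgc : ∀ n, Continuous (g n) := fun n => by fun_prop
  have hg0 : ∀ n ξ, ξ ∉ Ioo (p : ℝ) q → g n ξ = 0 := by
    intro n ξ hξ
    refine max_eq_left ((min_le_right _ _).trans ?_)
    refine mul_nonpos_of_nonneg_of_nonpos (Nat.cast_nonneg n) ?_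
    by_contra! hcon
    rw [lt_min_iff] at hcon
    exact hξ ⟨by linarith [hcon.1], by linarith [hcon.2]⟩
  have hgs : ∀ n, HasCompactSupport (g n) := fun n =>
    HasCompactSupport.intro (isCompact_Icc (a := (p : ℝ)) (b := q)) fun ξ hξ =>
      hg0 n ξ fun h => hξ (Ioo_subset_Icc_self h)
  let G : ℕ → C₀(ℝ, ℝ) := fun n => ⟨⟨g n, hgc n⟩, (hgs n).is_zero_at_infty⟩
  have hlim : ∀ ξ, Tendsto (fun n => g n ξ) atTop
      (𝓝 ((Ioo (p : ℝ) q).indicator (fun _ => (1 : ℝ)) ξ)) := by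
    intro ξ
    by_cases hξ : ξ ∈ Ioo (p : ℝ) q
    · rw [indicator_of_mem hξ]
      have hpos : 0 < min (ξ - p) (q - ξ) := lt_min (by linarith [hξ.1]) (by linarith [hξ.2])
      obtain ⟨N, hN⟩ := exists_nat_gt (1 / min (ξ - p) (q - ξ))
      refine tendsto_const_nhds.congr' ?_
      filter_upwards [eventually_ge_atTop N] with n hn
      have h1 : 1 ≤ n * min (ξ - p) (q - ξ) := by
        rw [← div_le_iff₀ hpos]
        exact hN.le.trans (by exact_mod_cast hn)
      simp only [g, min_eq_left h1, max_eq_right zero_le_one]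
    · rw [indicator_of_notMem hξ]
      exact tendsto_const_nhds.congr fun n => (hg0 n ξ hξ).symm
  have hreal : Measurable fun z => (σ.measureAt z).real (Ioo (p : ℝ) q) := by
    refine measurable_of_tendsto_metrizable (f := fun n z => ∫ ξ, g n ξ ∂(σ.measureAt z))
      (fun n => σ.weakStarMeasurable (G n)) (tendsto_pi_nhds.2 fun z => ?_)
    rw [← integral_indicator_one measurableSet_Ioo]
    refine tendsto_integral_of_dominated_convergence (fun _ => 1)
      (fun n => (hgc n).aestronglyMeasurable) (integrable_const _)
      (fun n => ae_of_all _ fun ξ => ?_) (ae_of_all _ hlim)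
    rw [Real.norm_of_nonneg (le_max_left _ _)]
    exact max_le zero_le_one (min_le_left _ _)
  have h1 := hreal.ennreal_ofReal
  simpa only [Measure.real, ENNReal.ofReal_toReal (measure_ne_top _ _)] using h1

/-- A uniformly bounded Young measure is the law of a bounded random field on the unit interval. -/
lemma YoungMeasure.exists_random_field {Z : Type*} [MeasurableSpace Z] (σ : YoungMeasure Z)
    (hσ : σ.UniformlyBounded) :
    ∃ (a b : ℝ) (u : unitInterval → Z → ℝ), a ≤ b ∧ (∀ ω z, u ω z ∈ Icc a b) ∧
      IsLawOf volume u σ := by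
  obtain ⟨K, hK, hsupp⟩ := hσ
  obtain ⟨M, hM⟩ := hK.isBounded.subset_closedBall 0
  have hKI : K ⊆ Icc (-|M|) |M| := fun ξ hξ => by
    have h := hM hξ
    rw [mem_closedBall_zero_iff] at h
    exact abs_le.1 (h.trans (le_abs_self M))
  have hab : -|M| ≤ |M| := by linarith [abs_nonneg M]
  have : ∀ z, IsProbabilityMeasure (σ.measureAt z) := fun z => (σ.toFun z).2
  let κ : ProbabilityTheory.Kernel Z ℝ := ⟨σ.measureAt, σ.measurable_measureAt⟩
  have : ProbabilityTheory.IsMarkovKernel κ := ⟨fun z => (σ.toFun z).2⟩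
  obtain ⟨g, hg, hgσ⟩ := κ.exists_measurable_map_eq_unitInterval
  have hmz : ∀ z, Measurable (g z) := fun z => hg.comp measurable_prodMk_left
  refine ⟨-|M|, |M|, fun ω z => max (-|M|) (min |M| (g z ω)), hab, fun ω z => clamp_mem hab _,
    ?_, fun z F hF => ?_⟩
  · exact measurable_const.max (measurable_const.min (hg.comp measurable_swap))
  · have hae : ∀ᵐ ω, g z ω ∈ Icc (-|M|) |M| := by
      refine ae_of_ae_map (hmz z).aemeasurable ?_
      rw [hgσ z]
      have h0 : ∀ᵐ ξ ∂(σ.measureAt z), ξ ∈ (σ.measureAt z).support :=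
        Measure.measure_compl_support
      exact h0.mono fun ξ hξ => hKI (hsupp z hξ)
    have h1 : σ.measureAt z F = volume {ω | g z ω ∈ F} := by
      rw [show σ.measureAt z = Measure.map (g z) volume from (hgσ z).symm,
        Measure.map_apply (hmz z) hF]
      rfl
    rw [h1]
    refine measure_congr (hae.mono fun ω hω => ?_)
    change (g z ω ∈ F) = (max (-|M|) (min |M| (g z ω)) ∈ F)
    rw [clamp_eq hω]

/-- Convergence of the approximate solutions for each `ω` implies convergence, along a subsequence
independent of `ω`, to a jointly measurable random field. -/
lemma exists_random_limit {Ω : Type*} [MeasurableSpace Ω] (P : Measure Ω) [IsProbabilityMeasure P]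
    {d : ℕ} {c : ℝ → Space d} {a b : ℝ} (hab : a ≤ b) (hc : Measurable c)
    {u₀ : Ω → Space d → ℝ} (hu₀ : Measurable (Function.uncurry u₀))
    (hu₀m : ∀ ω x, u₀ ω x ∈ Icc a b) {h : ℕ → ℝ}
    (hconv : ∀ u, Admissible a b u → ∀ t, 0 ≤ t → Tendsto (fun p : ℕ × ℕ =>
        wdist (approx c a b (h p.1) u t) (approx c a b (h p.2) u t)) atTop (𝓝 0)) :
    ∃ ψ : ℕ → ℕ, StrictMono ψ ∧ ∃ u : Ω → SpaceTime d → ℝ, Measurable (Function.uncurry u) ∧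
      (∀ ω z, u ω z ∈ Icc a b) ∧ ∀ᵐ ω ∂P, ∀ᵐ z : SpaceTime d,
        Tendsto (fun k => approx c a b (h (ψ k)) (u₀ ω) z.2 z.1) atTop (𝓝 (u ω z)) := by
  have hadm : ∀ ω, Admissible a b (u₀ ω) := fun ω =>
    ⟨hu₀.comp measurable_prodMk_left, hu₀m ω⟩
  set ρ : Measure Time := (volume : Measure Time).toFinite with hρ
  set m : Measure (SpaceTime d) := (weight d).prod ρ with hm
  have hac : (volume : Measure (SpaceTime d)) ≪ m :=
    (absolutelyContinuous_weight d).prod (absolutelyContinuous_toFinite _)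
  set U : ℕ → Ω × SpaceTime d → ℝ := fun k q => approx c a b (h k) (u₀ q.1) q.2.2 q.2.1 with hU
  have hUm : ∀ k, Measurable (U k) := fun k =>
    (measurable_approx_param hc hu₀).comp (measurable_fst.prodMk
      ((measurable_fst.comp measurable_snd).prodMk
        (measurable_subtype_coe.comp (measurable_snd.comp measurable_snd))))
  have hUI : ∀ k q, U k q ∈ Icc a b := fun k q => ((hadm q.1).approx hab hc _).mem _
  have hUL : ∀ k, MemLp (U k) 1 (P.prod m) := fun k =>
    MemLp.of_bound (hUm k).aestronglyMeasurable (|a| + |b|) (ae_of_all _ fun q =>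
      abs_le_of_monotone monotone_id (hUI k q))
  have hFm : ∀ p : ℕ × ℕ, Measurable fun q => ‖U p.1 q - U p.2 q‖ₑ := fun p =>
    ((hUm p.1).sub (hUm p.2)).enorm
  have hFb : ∀ (p : ℕ × ℕ) q, ‖U p.1 q - U p.2 q‖ₑ ≤ ENNReal.ofReal (b - a) := fun p q => by
    rw [Real.enorm_eq_ofReal_abs]
    exact ENNReal.ofReal_le_ofReal (abs_sub_le_of_mem_Icc (hUI _ _) (hUI _ _))
  have hin : ∀ ω, Tendsto (fun p : ℕ × ℕ => ∫⁻ z, ‖U p.1 (ω, z) - U p.2 (ω, z)‖ₑ ∂m) atTop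
      (𝓝 0) := by
    intro ω
    have hFω : ∀ p : ℕ × ℕ, Measurable fun z => ‖U p.1 (ω, z) - U p.2 (ω, z)‖ₑ := fun p =>
      (hFm p).comp measurable_prodMk_left
    have heq : ∀ p : ℕ × ℕ, ∫⁻ z, ‖U p.1 (ω, z) - U p.2 (ω, z)‖ₑ ∂m =
        ∫⁻ t : Time, wdist (approx c a b (h p.1) (u₀ ω) t) (approx c a b (h p.2) (u₀ ω) t) ∂ρ :=
      fun p => lintegral_prod_symm' _ (hFω p)
    simp only [heq]
    rw [← lintegral_zero (μ := ρ)]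
    refine tendsto_lintegral_filter_of_dominated_convergence
      (fun _ => ENNReal.ofReal (b - a) * weight d univ)
      (Eventually.of_forall fun p => (hFω p).lintegral_prod_left')
      (Eventually.of_forall fun p => ae_of_all _ fun t => ?_) ?_
      (ae_of_all _ fun t => hconv _ (hadm ω) t t.2)
    · exact wdist_le_of_forall fun x =>
        abs_sub_le_of_mem_Icc (hUI p.1 (ω, x, t)) (hUI p.2 (ω, x, t))
    · rw [lintegral_const]
      exact ENNReal.mul_ne_top (ENNReal.mul_ne_top ENNReal.ofReal_ne_top (measure_ne_top _ _))
        (measure_ne_top _ _)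
  have hout : Tendsto (fun p : ℕ × ℕ => ∫⁻ q, ‖U p.1 q - U p.2 q‖ₑ ∂(P.prod m)) atTop (𝓝 0) := by
    have heq : ∀ p : ℕ × ℕ, ∫⁻ q, ‖U p.1 q - U p.2 q‖ₑ ∂(P.prod m) =
        ∫⁻ ω, ∫⁻ z, ‖U p.1 (ω, z) - U p.2 (ω, z)‖ₑ ∂m ∂P :=
      fun p => lintegral_prod _ (hFm p).aemeasurable
    simp only [heq]
    rw [← lintegral_zero (μ := P)]
    refine tendsto_lintegral_filter_of_dominated_convergence
      (fun _ => ENNReal.ofReal (b - a) * m univ)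
      (Eventually.of_forall fun p => (hFm p).lintegral_prod_right')
      (Eventually.of_forall fun p => ae_of_all _ fun ω => ?_) ?_ (ae_of_all _ hin)
    · rw [← lintegral_const]
      exact lintegral_mono fun z => hFb p (ω, z)
    · rw [lintegral_const]
      exact ENNReal.mul_ne_top (ENNReal.mul_ne_top ENNReal.ofReal_ne_top (measure_ne_top _ _))
        (measure_ne_top _ _)
  have hcau : CauchySeq fun k => (hUL k).toLp (U k) := by
    rw [EMetric.cauchySeq_iff]
    intro ε hε
    obtain ⟨N, hN⟩ := eventually_atTop_prod_self.1 (hout.eventually (gt_mem_nhds hε))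
    refine ⟨N, fun k hk l hl => ?_⟩
    rw [Lp.edist_toLp_toLp, eLpNorm_one_eq_lintegral_enorm]
    exact hN k l hk hl
  obtain ⟨w, hw⟩ := cauchySeq_tendsto_of_complete hcau
  obtain ⟨ψ, hψ, hψw⟩ := (tendstoInMeasure_of_tendsto_Lp hw).exists_seq_tendsto_ae
  have hwm : Measurable (w : Ω × SpaceTime d → ℝ) := (Lp.stronglyMeasurable w).measurable
  refine ⟨ψ, hψ, fun ω z => max a (min b (w (ω, z))),
    measurable_const.max (measurable_const.min hwm), fun ω z => clamp_mem hab _, ?_⟩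
  have hae : ∀ᵐ q ∂(P.prod m),
      Tendsto (fun k => U (ψ k) q) atTop (𝓝 (max a (min b (w q)))) := by
    filter_upwards [hψw, ae_all_iff.2 fun k => (hUL k).coeFn_toLp] with q h1 h2
    simp only [h2] at h1
    rwa [clamp_eq (isClosed_Icc.mem_of_tendsto h1 (Eventually.of_forall fun k => hUI _ q))]
  exact (Measure.ae_ae_of_ae_prod hae).mono fun ω hω => hac.ae_le hω

/-! ### Laws of random solutions -/

section

variable {Ω : Type*} [MeasurableSpace Ω] {P : Measure Ω}

lemma stronglyMeasurable_expectation [SFinite P] {Z : Type*} [MeasurableSpace Z] {E : Type*}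
    [NormedAddCommGroup E] [NormedSpace ℝ E] {u : Ω → Z → ℝ} (hu : Measurable (Function.uncurry u))
    {g : ℝ → E} (hg : Continuous g) : StronglyMeasurable fun z => ∫ ω, g (u ω z) ∂P :=
  (hg.comp_stronglyMeasurable (hu.comp measurable_swap).stronglyMeasurable).integral_prod_right'
    (f := fun y : Z × Ω => g (u y.2 y.1)) (ν := P)

/-- The law of a random field. -/
noncomputable def lawOf {Z : Type*} [MeasurableSpace Z] (P : Measure Ω) [IsProbabilityMeasure P]
    (u : Ω → Z → ℝ) (hu : Measurable (Function.uncurry u)) : YoungMeasure Z where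
  toFun z := ⟨P.map fun ω => u ω z,
    Measure.isProbabilityMeasure_map (hu.comp measurable_prodMk_right).aemeasurable⟩
  weakStarMeasurable g := by
    have h1 : ∀ z, ∫ ξ, g ξ ∂(P.map fun ω => u ω z) = ∫ ω, g (u ω z) ∂P := fun z =>
      integral_map (hu.comp measurable_prodMk_right).aemeasurable
        g.continuous.aestronglyMeasurable
    simp only [ProbabilityMeasure.coe_mk, h1]
    exact (stronglyMeasurable_expectation hu g.continuous).measurable

lemma isLawOf_lawOf [IsProbabilityMeasure P] {Z : Type*} [MeasurableSpace Z] {u : Ω → Z → ℝ}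
    (hu : Measurable (Function.uncurry u)) : YoungMeasure.IsLawOf P u (lawOf P u hu) :=
  ⟨hu, fun _ _ hF => Measure.map_apply (hu.comp measurable_prodMk_right) hF⟩

namespace YoungMeasure

variable {Z : Type*} [MeasurableSpace Z] {u : Ω → Z → ℝ} {ν : YoungMeasure Z}

lemma IsLawOf.measureAt_eq (h : IsLawOf P u ν) (z : Z) :
    ν.measureAt z = P.map fun ω => u ω z := by
  ext F hF
  rw [h.2 z F hF]
  exact (Measure.map_apply (h.1.comp measurable_prodMk_right) hF).symm

lemma IsLawOf.pair_eq {E : Type*} [NormedAddCommGroup E] [NormedSpace ℝ E]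
    [SecondCountableTopology E] (h : IsLawOf P u ν) {g : ℝ → E} (hg : Continuous g) (z : Z) :
    ν.pair g z = ∫ ω, g (u ω z) ∂P := by
  rw [pair, h.measureAt_eq]
  exact integral_map (h.1.comp measurable_prodMk_right).aemeasurable
    hg.aestronglyMeasurable

lemma IsLawOf.pairingLocallyIntegrable [IsProbabilityMeasure P] {Z : Type*} [MeasureSpace Z]
    [TopologicalSpace Z] [IsLocallyFiniteMeasure (volume : Measure Z)] {u : Ω → Z → ℝ}
    {ν : YoungMeasure Z}
    (h : IsLawOf P u ν) {a b : ℝ} (hu : ∀ ω z, u ω z ∈ Icc a b) {E : Type*}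
    [NormedAddCommGroup E] {g : ℝ → E} (hg : Continuous g) : ν.PairingLocallyIntegrable g := by
  obtain ⟨M, hM⟩ := exists_norm_le_on hg a b
  have hsec : ∀ z, Measurable fun ω => u ω z := fun z => h.1.comp measurable_prodMk_right
  refine ⟨ae_of_all _ fun z => ?_, ?_⟩
  · rw [h.measureAt_eq, integrable_map_measure hg.aestronglyMeasurable (hsec z).aemeasurable]
    exact Integrable.of_bound (hg.aestronglyMeasurable.comp_measurable (hsec z)) M
      (ae_of_all _ fun ω => hM _ (hu ω z))
  · simp only [h.pair_eq hg.norm]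
    refine (locallyIntegrable_const M).mono ?_ (ae_of_all _ fun z => ?_)
    · exact (stronglyMeasurable_expectation h.1 hg.norm).aestronglyMeasurable
    · have h1 := norm_integral_le_of_norm_le_const (μ := P) (f := fun ω => ‖g (u ω z)‖) (C := M)
        (ae_of_all _ fun ω => by rw [norm_norm]; exact hM _ (hu ω z))
      rw [probReal_univ, mul_one] at h1
      exact h1.trans (le_abs_self M)

end YoungMeasure

instance (d : ℕ) : IsLocallyFiniteMeasure (volume : Measure (SpaceTime d)) := by
  have : LocallyCompactSpace Time := (isClosed_Ici (a := (0 : ℝ))).locallyCompactSpace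
  have : IsLocallyFiniteMeasure (volume : Measure Time) :=
    isLocallyFiniteMeasure_of_isFiniteMeasureOnCompacts
  rw [Measure.volume_eq_prod]
  infer_instance

open YoungMeasure in
/-- The weak form is linear in the fluxes and the data; hence the weak form of the law of a random
field is the expectation of the weak forms of the field. -/
lemma weakForm_law [IsProbabilityMeasure P] {d : ℕ} {σ : YoungMeasure (Space d)}
    {ν : YoungMeasure (SpaceTime d)} {u₀ : Ω → Space d → ℝ} {u : Ω → SpaceTime d → ℝ} {a b : ℝ}
    (h₀ : IsLawOf P u₀ σ) (h : IsLawOf P u ν) (hu₀ : ∀ ω x, u₀ ω x ∈ Icc a b)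
    (hu : ∀ ω z, u ω z ∈ Icc a b) {η : ℝ → ℝ} (hη : Continuous η) {q : ℝ → Space d}
    (hq : Continuous q) {φ : Space d × ℝ → ℝ} (hφ : IsTestFunction φ) :
    weakForm (ν.pair η) (ν.pair q) (σ.pair η) φ =
      ∫ ω, weakForm (fun z => η (u ω z)) (fun z => q (u ω z)) (fun x => η (u₀ ω x)) φ ∂P := by
  obtain ⟨M₁, hM₁⟩ := exists_norm_le_on hη a b
  obtain ⟨M₂, hM₂⟩ := exists_norm_le_on hq a b
  obtain ⟨R, C, hR0, hC0, hC, hC', hR, hR'⟩ := hφ.exists_bounds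
  have hsec : ∀ z, Measurable fun ω => u ω z := fun z => h.1.comp measurable_prodMk_right
  have hsec' : ∀ ω, Measurable (u ω) := fun ω => h.1.comp measurable_prodMk_left
  have hηb : ∀ ω z, |η (u ω z)| ≤ max M₁ M₂ := fun ω z =>
    (hM₁ _ (hu ω z)).trans (le_max_left _ _)
  have hqb : ∀ ω z, ‖q (u ω z)‖ ≤ max M₁ M₂ := fun ω z =>
    (hM₂ _ (hu ω z)).trans (le_max_right _ _)
  have hηi : ∀ z, Integrable (fun ω => η (u ω z)) P := fun z =>
    Integrable.of_bound (hη.measurable.comp (hsec z)).aestronglyMeasurable _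
      (ae_of_all _ fun ω => hηb ω z)
  have hqi : ∀ z, Integrable (fun ω => q (u ω z)) P := fun z =>
    Integrable.of_bound (hq.measurable.comp (hsec z)).aestronglyMeasurable _
      (ae_of_all _ fun ω => hqb ω z)
  have hpη : ν.pair η = fun z => ∫ ω, η (u ω z) ∂P := funext fun z => h.pair_eq hη z
  have hpq : ν.pair q = fun z => ∫ ω, q (u ω z) ∂P := funext fun z => h.pair_eq hq z
  have hpσ : σ.pair η = fun x => ∫ ω, η (u₀ ω x) ∂P := funext fun x => h₀.pair_eq hη x
  have havg : ∀ {E : Type} [NormedAddCommGroup E] [NormedSpace ℝ E] {g : Ω → E},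
      (∀ ω, ‖g ω‖ ≤ max M₁ M₂) → ‖∫ ω, g ω ∂P‖ ≤ max M₁ M₂ := fun hg => by
    have := norm_integral_le_of_norm_le_const (μ := P) (ae_of_all _ hg)
    rwa [probReal_univ, mul_one] at this
  rw [hpη, hpq, hpσ, hφ.weakForm_eq (M := max M₁ M₂)
    (stronglyMeasurable_expectation h.1 hη).measurable
    (stronglyMeasurable_expectation h.1 hq).measurable
    (fun z => havg (E := ℝ) fun ω => hηb ω z) (fun z => havg fun ω => hqb ω z)]
  have hω : ∀ ω, weakForm (fun z => η (u ω z)) (fun z => q (u ω z)) (fun x => η (u₀ ω x)) φ =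
      (∫ z : SpaceTime d, fderiv ℝ φ (z.1, z.2) (q (u ω z), η (u ω z))) +
        ∫ x, φ (x, 0) * η (u₀ ω x) := fun ω =>
    hφ.weakForm_eq (M := max M₁ M₂) (hη.measurable.comp (hsec' ω)) (hq.measurable.comp (hsec' ω))
      (hηb ω) (hqb ω) _
  simp only [hω]
  have hI1 : Integrable (fun y : Ω × SpaceTime d =>
      fderiv ℝ φ (y.2.1, y.2.2) (q (u y.1 y.2), η (u y.1 y.2))) (P.prod volume) := by
    refine integrable_of_bdd_of_support (S := univ ×ˢ slab d R R) (C := C * max M₁ M₂)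
      (measurable_fderiv_comp hφ ?_ ?_) ?_ (fun y =>
        IsTestFunction.abs_fderiv_le hC' (hηb _ _) (hqb _ _) _) fun y hy => ?_
    · exact (measurable_fst.comp measurable_snd).prodMk
        (measurable_subtype_coe.comp (measurable_snd.comp measurable_snd))
    · exact (hq.measurable.comp h.1).prodMk (hη.measurable.comp h.1)
    · rw [Measure.prod_prod]
      exact ENNReal.mul_ne_top (measure_ne_top _ _) (volume_slab_ne_top d R R)
    · rw [hR' _ (lt_norm_of_notMem_slab fun hz => hy ⟨trivial, hz⟩)]
      simp
  have hI2 : Integrable (fun y : Ω × Space d => φ (y.2, 0) * η (u₀ y.1 y.2)) (P.prod volume) := by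
    refine integrable_of_bdd_of_support (S := univ ×ˢ Metric.closedBall 0 R) (C := C * M₁)
      ((hφ.contDiff.continuous.measurable.comp (measurable_snd.prodMk measurable_const)).mul
        (hη.measurable.comp h₀.1)) ?_ (fun y => ?_) fun y hy => ?_
    · rw [Measure.prod_prod]
      exact ENNReal.mul_ne_top (measure_ne_top _ _) measure_closedBall_lt_top.ne
    · rw [abs_mul]; exact mul_le_mul (hC _) (hM₁ _ (hu₀ _ _)) (abs_nonneg _) hC0
    · have : R < ‖y.2‖ := by
        by_contra hcon
        exact hy ⟨trivial, mem_closedBall_zero_iff.2 (not_lt.1 hcon)⟩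
      rw [hR _ (this.trans_le (norm_fst_le (y.2, (0 : ℝ)))), zero_mul]
  rw [integral_add hI1.integral_prod_left hI2.integral_prod_left]
  congr 1
  · rw [integral_integral_swap hI1]
    refine integral_congr_ae (ae_of_all _ fun z => ?_)
    simp only
    rw [ContinuousLinearMap.integral_comp_comm _ ((hqi z).prodMk (hηi z)),
      integral_pair (hqi z) (hηi z)]
  · rw [integral_integral_swap hI2]
    simp only [integral_const_mul]

open YoungMeasure in
/-- The law of a bounded random entropy solution is an entropy measure-valued solution. -/
theorem isEMVSolution_of_isLawOf [IsProbabilityMeasure P] {d : ℕ} {f : ℝ → Space d}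
    (hf : ContDiff ℝ 1 f) {σ : YoungMeasure (Space d)} {ν : YoungMeasure (SpaceTime d)}
    {u₀ : Ω → Space d → ℝ} {u : Ω → SpaceTime d → ℝ} {a b : ℝ}
    (h₀ : IsLawOf P u₀ σ) (h : IsLawOf P u ν) (hu₀ : ∀ ω x, u₀ ω x ∈ Icc a b)
    (hu : ∀ ω z, u ω z ∈ Icc a b) (hsol : ∀ ω, IsEntropySolution f (u₀ ω) (u ω)) :
    IsEMVSolution f σ ν where
  integrable_id := h.pairingLocallyIntegrable hu continuous_id
  integrable_flux := h.pairingLocallyIntegrable hu hf.continuous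
  integrable_data := h₀.pairingLocallyIntegrable hu₀ continuous_id
  mv_eq φ hφ := by
    rw [weakForm_law h₀ h hu₀ hu (η := fun ξ => ξ) continuous_id hf.continuous hφ]
    exact integral_eq_zero_of_ae (ae_of_all _ fun ω => (hsol ω).weak_eq φ hφ)
  entropy_integrable η q hηq :=
    ⟨h.pairingLocallyIntegrable hu hηq.continuous_entropy,
      h.pairingLocallyIntegrable hu (hηq.continuous_flux hf),
      h₀.pairingLocallyIntegrable hu₀ hηq.continuous_entropy⟩
  entropy_ineq η q hηq φ hφ hpos := by
    rw [weakForm_law h₀ h hu₀ hu hηq.continuous_entropy (hηq.continuous_flux hf) hφ]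
    exact integral_nonneg fun ω => (hsol ω).entropy_ineq η q hηq φ hφ hpos

end

end ScalarCL

open ScalarCL in
theorem theorem3p1 (d : ℕ) (f : ℝ → Space d) (hf : ContDiff ℝ 1 f)
    (σ : YoungMeasure (Space d)) (hσ : σ.UniformlyBounded) :
    ∃ ν : YoungMeasure (SpaceTime d),
      IsEMVSolution f σ ν ∧
      ∃ (Ω : Type) (_ : MeasurableSpace Ω) (P : Measure Ω) (_ : IsProbabilityMeasure P)
        (u₀ : Ω → Space d → ℝ) (u : Ω → SpaceTime d → ℝ),
        YoungMeasure.IsLawOf P u₀ σ ∧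
        (∀ ω : Ω, IsEntropySolution f (u₀ ω) (u ω)) ∧
        YoungMeasure.IsLawOf P u ν := by
  obtain ⟨a, b, u₀, hab, hu₀, hlaw⟩ := σ.exists_random_field hσ
  obtain ⟨L, hL0, hL⟩ := exists_speed_le hf hab
  have hc := (continuous_speed hf a b).measurable
  obtain ⟨h, hh0, hh1, hh, hconv⟩ := exists_steps_tendsto hab hc hL0 fun ξ _ => hL ξ
  obtain ⟨ψ, hψ, u, hum, hu, hae⟩ :=
    exists_random_limit (volume : Measure unitInterval) hab hc hlaw.1 hu₀ hconv
  -- On a null set of `ω` the data are replaced by those of one `ω₀` outside of it.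
  obtain ⟨N, hN, hNm, hN0⟩ := exists_measurable_superset_of_null (ae_iff.1 hae)
  have hNae : ∀ᵐ ω : unitInterval, ω ∉ N := measure_eq_zero_iff_ae_notMem.1 hN0
  obtain ⟨ω₀, hω₀⟩ := hNae.exists
  classical
  let r : unitInterval → unitInterval := fun ω => if ω ∈ N then ω₀ else ω
  have hr : Measurable r := Measurable.ite hNm measurable_const measurable_id
  have hrN : ∀ ω, r ω ∉ N := fun ω => by
    by_cases h : ω ∈ N <;> simp [r, h, hω₀]
  have hrae : ∀ᵐ ω, r ω = ω := hNae.mono fun ω hω => by simp [r, hω]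
  have hr2 : ∀ {X : Type} [MeasurableSpace X],
      Measurable fun p : unitInterval × X => (r p.1, p.2) :=
    fun {X} _ => (hr.comp measurable_fst).prodMk measurable_snd
  have hlaw' : YoungMeasure.IsLawOf volume (fun ω => u₀ (r ω)) σ := by
    refine ⟨hlaw.1.comp hr2, fun x F hF => ?_⟩
    rw [hlaw.2 x F hF]
    refine measure_congr (hrae.mono fun ω hω => ?_)
    change (u₀ ω x ∈ F) = (u₀ (r ω) x ∈ F)
    rw [hω]
  have hum' : Measurable (Function.uncurry fun ω => u (r ω)) := hum.comp hr2
  have hsol : ∀ ω, IsEntropySolution f (u₀ (r ω)) (u (r ω)) := fun ω =>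
    isEntropySolution_of_tendsto hf hab
      ⟨hlaw.1.comp measurable_prodMk_left, hu₀ (r ω)⟩ (fun k => hh0 (ψ k)) (fun k => hh1 (ψ k))
      (hh.comp hψ.tendsto_atTop) (hum.comp measurable_prodMk_left) (hu (r ω))
      (by_contra fun hcon => hrN ω (hN hcon))
  exact ⟨lawOf volume _ hum', isEMVSolution_of_isLawOf hf hlaw' (isLawOf_lawOf hum')
    (fun ω => hu₀ (r ω)) (fun ω => hu (r ω)) hsol, unitInterval, inferInstance, volume,
    inferInstance, _, _, hlaw', hsol, isLawOf_lawOf hum'⟩
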